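/- Theorem 1.3. Let $l$ be an odd positive integer. For $\tau$ in the complex upper half plane $\mathbb{H}$ and $z\in\mathbb{C}\setminus(\mathbb{Z}\tau+\mathbb{Z})$ put $q=e^{2\pi i\tau}$, $w=e^{2\pi iz}$ (and $q^a=e^{2\pi i a\tau}$, $w^a=e^{2\pi i a z}$ for $a\in\mathbb{Q}$), and let $$A_l(z;\tau)=w^{l/2}\sum_{n\in\mathbb{Z}}\frac{(-1)^{ln}q^{\frac l2 n(n+1)}}{1-wq^n},\qquad \mathcal{C}(z;\tau)=\frac{w^{1/2}q^{-1/24}}{1-w}\prod_{n=1}^\infty\frac{1-q^n}{(1-wq^n)(1-w^{-1}q^n)},$$ the level $l$ Appell function and the modified crank generating function. Let $\eta(\tau)=q^{1/24}\prod_{n\ge1}(1-q^n)$, let $E_2(\tau)=1-24\sum_{n\ge1}\bigl(\sum_{d\mid n}d\bigr)q^n$, and define $$\mathcal{H}_k=\frac{l}{\pi i}\frac{\partial}{\partial\tau}+\frac1{(2\pi i)^2}\frac{\partial^2}{\partial z^2}-\frac{l(2k-1)}{12}E_2,\qquad \mathcal{H}^k=\mathcal{H}_{2k-1}\mathcal{H}_{2k-3}\cdots\mathcal{H}_3\mathcal{H}_1$$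 (with $\mathcal{H}^0$ the identity). Then there exist holomorphic modular forms $f_j$ on $\mathrm{SL}_2(\mathbb{Z})$ of weight $j$ ($j=0,2,4,\ldots,l-1$), with $f_0$ a non-zero constant, such that $$\sum_{k=0}^{(l-1)/2}f_{l-2k-1}(\tau)\,(\mathcal{H}^kA_l)(z;\tau)=(l-1)!\,f_0(\tau)\,\eta(\tau)^l\,\mathcal{C}(z;\tau)^l$$ for all $\tau\in\mathbb{H}$ and all $z\in\mathbb{C}\setminus(\mathbb{Z}\tau+\mathbb{Z})$. -/

import Mathlib

open Complex UpperHalfPlane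
open scoped Real MatrixGroups

noncomputable section

namespace AppellPDE

/-- `e x = exp (2 π i x)`; thus `w = e z`, `q = e τ`, and `w ^ a * q ^ b = e (a * z + b * τ)`
for rational exponents `a`, `b`. -/
def e (x : ℂ) : ℂ := Complex.exp (2 * (π : ℂ) * Complex.I * x)

/-- The level `l` Appell function
`w ^ (l / 2) * ∑ n : ℤ, (-1) ^ (l n) q ^ (l n (n + 1) / 2) / (1 - w q ^ n)`. -/
def appell (l : ℕ) (z : ℂ) (τ : ℍ) : ℂ :=
  e ((l : ℂ) / 2 * z) *
    ∑' n : ℤ, (-1 : ℂ) ^ ((l : ℤ) * n) * e ((l : ℂ) / 2 * (n : ℂ) * ((n : ℂ) + 1) * (τ : ℂ)) /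
      (1 - e z * e (τ : ℂ) ^ n)

/-- The crank generating function
`C(w; q) = ∏ n ≥ 1, (1 - q ^ n) / ((1 - w q ^ n) (1 - w⁻¹ q ^ n))`. -/
def crankGen (w q : ℂ) : ℂ :=
  ∏' n : ℕ, (1 - q ^ (n + 1)) / ((1 - w * q ^ (n + 1)) * (1 - w⁻¹ * q ^ (n + 1)))

/-- The modified crank generating function `w ^ (1 / 2) q ^ (- 1 / 24) / (1 - w) * C(w; q)`. -/
def modCrank (z : ℂ) (τ : ℍ) : ℂ :=
  e (z / 2) * e (-(τ : ℂ) / 24) / (1 - e z) * crankGen (e z) (e (τ : ℂ))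

/-- The modified heat operator (of level `l`)
`H_k = (l / (π i)) ∂/∂τ + (2 π i)⁻² ∂²/∂z² - (l (2 k - 1) / 12) E₂`. -/
def heatOp (l k : ℕ) (F : ℂ → ℍ → ℂ) : ℂ → ℍ → ℂ := fun z τ ↦
  (l : ℂ) / ((π : ℂ) * Complex.I) * deriv (fun t : ℂ ↦ F z (ofComplex t)) (τ : ℂ)
    + 1 / (2 * (π : ℂ) * Complex.I) ^ 2 * iteratedDeriv 2 (fun x : ℂ ↦ F x τ) z
    - (l : ℂ) * (2 * (k : ℂ) - 1) / 12 * EisensteinSeries.E2 τ * F z τ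

/-- The composition `H_{2k-1} H_{2k-3} ⋯ H_3 H_1` (the identity for `k = 0`). -/
def heatPow (l : ℕ) : ℕ → (ℂ → ℍ → ℂ) → (ℂ → ℍ → ℂ)
  | 0, F => F
  | k + 1, F => heatOp l (2 * k + 1) (heatPow l k F)

end AppellPDE

end

noncomputable section

namespace AppellPDE

open Derivative Filter
open scoped Topology Manifold ModularForm

/-! Write `l = 2 d + 1`, `D = (2πi)⁻¹ ∂/∂τ`, and let `L` be the heat operator without its `E₂` term.
Each summand of the Appell function is an exponential times a function of `z + n τ`, and the
exponential is such that `L` acts on the summand as `(2πi)⁻² ∂²` on that function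
(`heat_appellTerm`). Hence `L ^ k A_l` is the explicit series `appellSum l k`, and `H ^ k A_l` is a
combination of these with coefficients `heatCoeff` depending on `τ` only (`heatPow_appell`).

Under `z ↦ z + τ` the series `appellSum l k` has the multiplier of an `l`-th power of an inverse
theta function, up to an error built from `thetaSum l k a`, which is `(2 l D) ^ k` of a unary theta
series (`appellSum_add_tau`). So a combination of the `L ^ k A_l` is exactly elliptic as soon as the
same combination of the `(2 l D) ^ k` annihilates these theta series. Multiplied by the `l`-th power
of the theta product it is doubly periodic, its only possible pole is removable, and it is constant.
Only `k = d` reaches pole order `l`, which gives the constant and its factor `(l - 1)!`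
(`thetaProd_pow_mul_sum_appellSum`). Dividing by the theta power produces the crank function
(`modCrank_mul_thetaProd`).

It remains to find a modular differential equation for the theta series. Up to sign there are `d` of
them; divided by `η` they span a weight zero representation of `SL(2, ℤ)`. Their Wronskian in Serre
derivatives has weight `d (d - 1)`, and the exponents at `i∞` add up to exactly `d (d - 1) / 12`, so
it has no zeros in the upper half plane (`IsModularFrame.det_ne_zero`). Cramer's rule then gives a
monic equation whose coefficients are holomorphic modular forms
(`IsModularFrame.exists_modularForm_sum_eq_zero`). Removing `η` turns iterated Serre derivatives
into the same `heatCoeff` combinations (`serreIter_thetaQuot`), so these coefficients, rescaled, are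
the `f_j`. -/

/-! ### Behaviour at the cusp: derivatives, `η` and `E₂` -/

/-- The normalized derivative of a holomorphic function with a limit at `i∞` tends to `0`. -/
lemma tendsto_normalizedDeriv_atImInfty {F : ℍ → ℂ} {c : ℂ} (hF : MDiff F)
    (hlim : Tendsto F atImInfty (𝓝 c)) :
    Tendsto (normalizedDerivOfComplex F) atImInfty (𝓝 0) := by
  have key : Tendsto (fun τ : ℍ ↦ deriv (F ∘ ofComplex) τ) atImInfty (𝓝 0) := by
    rw [Metric.tendsto_nhds]
    intro ε hε
    have h1 := (Metric.tendsto_nhds.mp hlim) (ε / 2) (by positivity)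
    obtain ⟨A, hA⟩ := (atImInfty_mem _).mp h1
    -- The margin `2` keeps the closed unit disc around `τ` inside the upper half plane and inside
    -- the region where `F` is `ε / 2`-close to `c`; Cauchy's estimate on that disc bounds the
    -- derivative.
    refine (atImInfty_mem _).mpr ⟨max A 0 + 2, fun τ hτ ↦ ?_⟩
    have him : ∀ z ∈ Metric.closedBall (τ : ℂ) 1, max A 0 + 1 ≤ z.im := by
      intro z hz
      have h2 : |(z - τ).im| ≤ 1 := (abs_im_le_norm _).trans (by simpa [dist_eq_norm] using hz)
      have h3 := (abs_le.mp h2).1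
      rw [sub_im] at h3
      have h4 : (τ : ℂ).im = τ.im := rfl
      linarith
    have hdiff : DifferentiableOn ℂ (F ∘ ofComplex) {z | 0 < z.im} :=
      UpperHalfPlane.mdifferentiable_iff.mp hF
    have hpos : ∀ z ∈ Metric.closedBall (τ : ℂ) 1, 0 < z.im := fun z hz ↦ by
      have := him z hz
      have := le_max_right A 0
      linarith
    have hcb : DiffContOnCl ℂ (fun z ↦ (F ∘ ofComplex) z - c) (Metric.ball (τ : ℂ) 1) :=
      (((hdiff.mono hpos).sub_const c).mono
        (Metric.closure_ball_subset_closedBall)).diffContOnCl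
    have hbd := Complex.norm_deriv_le_of_forall_mem_sphere_norm_le (C := ε / 2) one_pos hcb
      (fun z hz ↦ by
        have hz' := Metric.sphere_subset_closedBall hz
        have h5 := hA ⟨z, hpos z hz'⟩ (by
          have := him z hz'
          have := le_max_left A 0
          change A ≤ z.im
          linarith)
        simp only [Function.comp_apply, ofComplex_apply_of_im_pos (hpos z hz')]
        have h6 : dist (F ⟨z, hpos z hz'⟩) c < ε / 2 := h5
        rw [dist_eq_norm] at h6
        exact h6.le)
    rw [deriv_sub_const_fun] at hbd
    change dist _ _ < ε
    rw [dist_zero_right]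
    linarith
  have h := key.const_mul ((2 * π * Complex.I : ℂ)⁻¹)
  rwa [mul_zero] at h

lemma tendsto_eta_tprod_atImInfty :
    Tendsto (fun τ : ℍ ↦ ∏' n, (1 - ModularForm.eta_q n τ)) atImInfty (𝓝 1) := by
  have htprod : Tendsto (fun q : ℂ ↦ ∏' (n : ℕ), (1 - q ^ (n + 1))) (𝓝 0) (𝓝 1) := by
    have h := (ModularForm.differentiableOn_tprod_one_sub_pow.continuousOn.continuousAt
      (Metric.isOpen_ball.mem_nhds (Metric.mem_ball_self one_pos))).tendsto
    simpa using h
  exact htprod.comp (UpperHalfPlane.qParam_tendsto_atImInfty zero_lt_one)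

lemma mdifferentiable_of_differentiableAt {f : ℂ → ℂ}
    (hf : ∀ z : ℂ, 0 < z.im → DifferentiableAt ℂ f z) : MDiff (fun τ : ℍ ↦ f τ) := by
  rw [UpperHalfPlane.mdifferentiable_iff]
  intro z hz
  refine (hf z hz).differentiableWithinAt.congr (fun w hw ↦ ?_) ?_
  · simp [ofComplex_apply_of_im_pos hw]
  · simp [ofComplex_apply_of_im_pos hz]

lemma mdifferentiable_div {F G : ℍ → ℂ} (hF : MDiff F) (hG : MDiff G) (h0 : ∀ τ, G τ ≠ 0) :
    MDiff (fun τ ↦ F τ / G τ) := by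
  rw [UpperHalfPlane.mdifferentiable_iff] at *
  exact hF.div hG fun z _ ↦ h0 _

lemma mdifferentiable_sum {ι : Type*} (s : Finset ι) {F : ι → ℍ → ℂ} (hF : ∀ i ∈ s, MDiff (F i)) :
    MDiff (fun τ ↦ ∑ i ∈ s, F i τ) := by
  rw [UpperHalfPlane.mdifferentiable_iff]
  have := DifferentiableOn.fun_sum (u := s) (A := fun i ↦ F i ∘ ofComplex)
    fun i hi ↦ UpperHalfPlane.mdifferentiable_iff.mp (hF i hi)
  exact this

lemma mdifferentiable_prod {ι : Type*} (s : Finset ι) {F : ι → ℍ → ℂ}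
    (hF : ∀ i ∈ s, MDiff (F i)) : MDiff (fun τ ↦ ∏ i ∈ s, F i τ) := by
  rw [UpperHalfPlane.mdifferentiable_iff]
  have := DifferentiableOn.fun_finsetProd (u := s) (f := fun i ↦ F i ∘ ofComplex)
    fun i hi ↦ UpperHalfPlane.mdifferentiable_iff.mp (hF i hi)
  exact this

lemma mdifferentiable_pow {F : ℍ → ℂ} (hF : MDiff F) (n : ℕ) : MDiff (fun τ ↦ F τ ^ n) := by
  rw [UpperHalfPlane.mdifferentiable_iff] at *
  exact hF.pow n

lemma mdifferentiable_const_mul {F : ℍ → ℂ} (c : ℂ) (hF : MDiff F) : MDiff (fun τ ↦ c * F τ) := by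
  rw [UpperHalfPlane.mdifferentiable_iff] at *
  exact hF.const_mul c

lemma mdifferentiable_mul {F G : ℍ → ℂ} (hF : MDiff F) (hG : MDiff G) :
    MDiff (fun τ ↦ F τ * G τ) := by
  rw [UpperHalfPlane.mdifferentiable_iff] at *
  exact hF.mul hG

lemma mdifferentiable_det {n : Type*} [Fintype n] [DecidableEq n] {A : ℍ → Matrix n n ℂ}
    (hA : ∀ i j, MDiff (fun τ ↦ A τ i j)) : MDiff (fun τ ↦ (A τ).det) := by
  simp_rw [Matrix.det_apply']
  exact mdifferentiable_sum _ fun σ _ ↦ mdifferentiable_const_mul _ <|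
    mdifferentiable_prod _ fun i _ ↦ hA _ _

lemma mdifferentiable_eta : MDiff (fun τ : ℍ ↦ ModularForm.eta τ) :=
  mdifferentiable_of_differentiableAt
    fun _ hz ↦ ModularForm.differentiableAt_eta_of_mem_upperHalfPlaneSet hz

lemma normalizedDeriv_eq_of_hasDerivAt {f : ℂ → ℂ} {f' : ℂ} (τ : ℍ) (hf : HasDerivAt f f' τ) :
    normalizedDerivOfComplex (fun τ : ℍ ↦ f τ) τ = (2 * π * Complex.I : ℂ)⁻¹ * f' := by
  rw [normalizedDerivOfComplex]
  congr 1
  refine (hf.congr_of_eventuallyEq ?_).deriv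
  filter_upwards [isOpen_upperHalfPlaneSet.mem_nhds τ.im_pos] with w hw
  simp [ofComplex_apply_of_im_pos hw]

lemma normalizedDeriv_eta (τ : ℍ) :
    normalizedDerivOfComplex (fun τ : ℍ ↦ ModularForm.eta τ) τ =
      EisensteinSeries.E2 τ / 24 * ModularForm.eta τ := by
  have h := ModularForm.logDeriv_eta_eq_E2 τ
  rw [logDeriv_apply, div_eq_iff (ModularForm.eta_ne_zero τ.2)] at h
  rw [normalizedDeriv_eq_of_hasDerivAt τ
    (ModularForm.differentiableAt_eta_of_mem_upperHalfPlaneSet τ.2).hasDerivAt, h]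
  have : (π : ℂ) ≠ 0 := by exact_mod_cast Real.pi_ne_zero
  field_simp
  ring

lemma normalizedDeriv_cexp (a : ℂ) (τ : ℍ) :
    normalizedDerivOfComplex (fun τ : ℍ ↦ e (a * τ)) τ = a * e (a * τ) := by
  have : HasDerivAt (fun z : ℂ ↦ e (a * z)) (e (a * τ) * (2 * π * Complex.I * (a * 1))) τ := by
    unfold e
    exact (((hasDerivAt_id (τ : ℂ)).const_mul a).const_mul _).cexp
  rw [normalizedDeriv_eq_of_hasDerivAt τ this]
  have : (π : ℂ) ≠ 0 := by exact_mod_cast Real.pi_ne_zero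
  field_simp

lemma mdifferentiable_cexp (a : ℂ) : MDiff (fun τ : ℍ ↦ e (a * τ)) :=
  mdifferentiable_of_differentiableAt (f := fun z ↦ e (a * z)) fun z _ ↦ by unfold e; fun_prop

lemma e_add (x y : ℂ) : e (x + y) = e x * e y := by
  rw [e, e, e, mul_add, Complex.exp_add]

lemma e_ne_zero (x : ℂ) : e x ≠ 0 := Complex.exp_ne_zero _

@[simp] lemma e_zero : e 0 = 1 := by simp [e]

lemma e_neg (x : ℂ) : e (-x) = (e x)⁻¹ := by simp [e, Complex.exp_neg]

lemma e_int (n : ℤ) : e n = 1 := by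
  rw [e, Complex.exp_eq_one_iff]
  exact ⟨n, by ring⟩

lemma e_pow (x : ℂ) (n : ℕ) : e x ^ n = e (n * x) := by
  rw [e, e, ← Complex.exp_nat_mul]
  ring_nf

lemma norm_e (x : ℂ) : ‖e x‖ = Real.exp (-2 * π * x.im) := by
  rw [e, Complex.norm_exp]
  simp

lemma eta_eq (τ : ℍ) :
    ModularForm.eta τ = e (1 / 24 * τ) * ∏' n, (1 - ModularForm.eta_q n τ) := by
  rw [ModularForm.eta, e, Function.Periodic.qParam]
  congr 2
  push_cast
  ring

lemma tendsto_e_mul_eta :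
    Tendsto (fun τ : ℍ ↦ e (-(1 / 24) * τ) * ModularForm.eta τ) atImInfty (𝓝 1) := by
  refine tendsto_eta_tprod_atImInfty.congr fun τ ↦ ?_
  rw [eta_eq, ← mul_assoc, ← e_add]
  simp

/-- `q ^ (-1/24) η` tends to `1`, so its logarithmic derivative `(E₂ - 1) / 24` tends to `0`. -/
lemma tendsto_E2_atImInfty : Tendsto EisensteinSeries.E2 atImInfty (𝓝 1) := by
  have hmd : MDiff (fun τ : ℍ ↦ e (-(1 / 24) * τ) * ModularForm.eta τ) :=
    mdifferentiable_mul (mdifferentiable_cexp _) mdifferentiable_eta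
  have h0 := tendsto_normalizedDeriv_atImInfty hmd tendsto_e_mul_eta
  have h1 := h0.div tendsto_e_mul_eta one_ne_zero
  have h2 := (h1.const_mul 24).add_const 1
  simp only [zero_div, mul_zero, zero_add] at h2
  refine h2.congr fun τ ↦ ?_
  have := congrFun (normalizedDerivOfComplex_mul _ _ (mdifferentiable_cexp (-(1 / 24)))
    mdifferentiable_eta) τ
  simp only [Pi.add_apply, Pi.mul_apply, normalizedDeriv_eta, normalizedDeriv_cexp] at this
  simp only [Pi.div_apply]
  erw [this]
  have h3 := ModularForm.eta_ne_zero τ.2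
  have h4 := e_ne_zero (-(1 / 24) * τ)
  change ModularForm.eta (τ : ℂ) ≠ 0 at h3
  generalize e (-(1 / 24) * τ) = x at *
  field_simp
  ring

/-! ### Iterated Serre derivatives -/

/-- Iterated Serre derivative, starting in weight `0`. -/
def serreIter : ℕ → (ℍ → ℂ) → ℍ → ℂ
  | 0, F => F
  | n + 1, F => serreDerivative ((2 * n : ℤ) : ℂ) (serreIter n F)

lemma mdifferentiable_serreIter (n : ℕ) {F : ℍ → ℂ} (hF : MDiff F) : MDiff (serreIter n F) := by
  induction n with
  | zero => exact hF
  | succ n ih => exact serreDerivative_mdifferentiable _ ih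

/-- No invariance of `F` is assumed: the components of a vector-valued form are only mixed linearly
by the group, and the slash has to pass through to them. -/
lemma serreIter_slash (n : ℕ) {F : ℍ → ℂ} (hF : MDiff F) (γ : SL(2, ℤ)) :
    serreIter n F ∣[(2 * n : ℤ)] γ = serreIter n (F ∣[(0 : ℤ)] γ) := by
  induction n with
  | zero => simp [serreIter]
  | succ n ih =>
    rw [serreIter, serreIter, ← ih,
      ← serreDerivative_slash_equivariant (mdifferentiable_serreIter n hF)]
    push_cast
    ring_nf

lemma serreIter_sum (n : ℕ) {ι : Type*} (s : Finset ι) (c : ι → ℂ) {F : ι → ℍ → ℂ}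
    (hF : ∀ i ∈ s, MDiff (F i)) :
    serreIter n (fun τ ↦ ∑ i ∈ s, c i * F i τ) = fun τ ↦ ∑ i ∈ s, c i * serreIter n (F i) τ := by
  classical
  induction n with
  | zero => rfl
  | succ n ih =>
    rw [serreIter, ih]
    have hG : ∀ i ∈ s, MDiff (serreIter n (F i)) := fun i hi ↦ mdifferentiable_serreIter n (hF i hi)
    generalize hGdef : (fun i ↦ serreIter n (F i)) = G at *
    have hGdef' : ∀ i, serreIter n (F i) = G i := fun i ↦ congrFun hGdef i
    simp only [serreIter, hGdef'] at hG ⊢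
    clear ih hF hGdef hGdef'
    induction s using Finset.induction_on with
    | empty =>
      ext τ
      simp [serreDerivative, normalizedDerivOfComplex, Function.comp_def]
    | insert a s ha ih =>
      have h1 := serreDerivative_add ((2 * n : ℤ) : ℂ) (c a • G a) (fun τ ↦ ∑ i ∈ s, c i * G i τ)
        (mdifferentiable_const_mul _ (hG a (by simp)))
        (mdifferentiable_sum _ fun i hi ↦ mdifferentiable_const_mul _ (hG i (by simp [hi])))
      rw [serreDerivative_smul _ _ _ (hG a (by simp)), ih fun i hi ↦ hG i (by simp [hi])] at h1
      convert h1 using 1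
      · congr 1
        ext τ
        simp [Finset.sum_insert ha]
      · ext τ
        simp [Finset.sum_insert ha]

/-- The leading coefficient at `i∞` of an iterated Serre derivative. -/
lemma tendsto_serreIter {F : ℍ → ℂ} (hF : MDiff F) (α : ℂ)
    (h : Tendsto (fun τ : ℍ ↦ e (-α * τ) * F τ) atImInfty (𝓝 1)) (n : ℕ) :
    Tendsto (fun τ : ℍ ↦ e (-α * τ) * serreIter n F τ) atImInfty
      (𝓝 (∏ i ∈ Finset.range n, (α - i / 6))) := by
  induction n with
  | zero => simpa [serreIter] using h
  | succ n ih =>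
    have hmd := mdifferentiable_serreIter n hF
    have h1 := tendsto_normalizedDeriv_atImInfty
      (mdifferentiable_mul (mdifferentiable_cexp (-α)) hmd) ih
    have h2 := (h1.add (ih.const_mul α)).sub ((tendsto_E2_atImInfty.mul ih).const_mul (n / 6 : ℂ))
    rw [Finset.prod_range_succ]
    convert h2.congr fun τ ↦ ?_ using 2
    · ring
    have := congrFun (normalizedDerivOfComplex_mul _ _ (mdifferentiable_cexp (-α)) hmd) τ
    simp only [Pi.add_apply, Pi.mul_apply, normalizedDeriv_cexp] at this
    erw [this]
    rw [serreIter, serreDerivative]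
    push_cast
    ring

/-! ### Modular frames, their Wronskian and their differential equation -/

/-- `S` and `T` generate, and invariance carries boundedness at `i∞` to every cusp. -/
lemma exists_modularForm_of_slash {k : ℤ} {f : ℍ → ℂ} (hmd : MDiff f)
    (hS : f ∣[k] ModularGroup.S = f) (hT : f ∣[k] ModularGroup.T = f)
    (hbdd : IsBoundedAtImInfty f) : ∃ F : ModularForm 𝒮ℒ k, ⇑F = f := by
  have hall := SlashInvariantForm.slash_action_generators_SL2Z hS hT
  refine ⟨{ toFun := f, slash_action_eq' := ?_, holo' := hmd, bdd_at_cusps' := ?_ }, rfl⟩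
  · rintro A ⟨A, rfl⟩
    exact hall A
  · intro c hc
    rw [Subgroup.IsArithmetic.isCusp_iff_isCusp_SL2Z] at hc
    rw [OnePoint.isBoundedAt_iff_forall_SL2Z hc]
    intro γ _
    rw [hall]
    exact hbdd

lemma isBoundedAtImInfty_of_tendsto {f : ℍ → ℂ} {c : ℂ} (hf : Tendsto f atImInfty (𝓝 c)) :
    IsBoundedAtImInfty f :=
  hf.isBigO_one ℝ

/-- The Wronskian-type matrix of iterated Serre derivatives. -/
def serreMatrix {d : ℕ} (h : Fin d → ℍ → ℂ) (τ : ℍ) : Matrix (Fin d) (Fin d) ℂ :=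
  Matrix.of fun i j ↦ serreIter i (h j) τ

/-- `d` holomorphic functions with independent leading exponents `α j` at `i∞` spanning a
representation of `SL(2, ℤ)` in weight `0`, such that the Wronskian has minimal order. -/
structure IsModularFrame {d : ℕ} (h : Fin d → ℍ → ℂ) (α : Fin d → ℂ) : Prop where
  mdiff : ∀ j, MDiff (h j)
  slash_T : ∀ j, h j ∣[(0 : ℤ)] ModularGroup.T = fun τ ↦ e (α j) * h j τ
  slash_S : ∃ ρ : Matrix (Fin d) (Fin d) ℂ,
    ∀ j, h j ∣[(0 : ℤ)] ModularGroup.S = fun τ ↦ ∑ i, ρ i j * h i τ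
  inj : Function.Injective α
  sum_exponent : 12 * ∑ j, α j = (d * (d - 1) : ℕ)
  tendsto : ∀ j, Tendsto (fun τ : ℍ ↦ e (-α j * τ) * h j τ) atImInfty (𝓝 1)

lemma serreIter_smul {d : ℕ} {h : Fin d → ℍ → ℂ} (hmd : ∀ j, MDiff (h j))
    {ρ : Matrix (Fin d) (Fin d) ℂ} {γ : SL(2, ℤ)}
    (hρ : ∀ j, h j ∣[(0 : ℤ)] γ = fun τ ↦ ∑ i, ρ i j * h i τ) (n : ℕ) (j : Fin d) (τ : ℍ) :
    serreIter n (h j) (γ • τ) = denom γ τ ^ (2 * n) * ∑ i, serreIter n (h i) τ * ρ i j := by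
  have h1 := congrFun (serreIter_slash n (hmd j) γ) τ
  rw [hρ, serreIter_sum n _ _ fun i _ ↦ hmd i, ModularForm.SL_slash_apply] at h1
  have h2 : ∑ i, serreIter n (h i) τ * ρ i j = ∑ i, ρ i j * serreIter n (h i) τ :=
    Finset.sum_congr rfl fun i _ ↦ mul_comm _ _
  have h3 := denom_ne_zero γ τ
  rw [h2]
  refine Eq.trans ?_ (congrArg (denom γ τ ^ (2 * n) * ·) h1)
  have h4 : denom γ τ ^ (-(2 * n : ℤ)) = (denom γ τ ^ (2 * n))⁻¹ := by
    rw [zpow_neg]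
    norm_cast
  simp only [h4]
  field_simp

/-- Row `i` has weight `2 i`, and these weights add up to `d (d - 1)`. -/
lemma det_serreMatrix_smul {d : ℕ} {h : Fin d → ℍ → ℂ} (hmd : ∀ j, MDiff (h j))
    {ρ : Matrix (Fin d) (Fin d) ℂ} {γ : SL(2, ℤ)}
    (hρ : ∀ j, h j ∣[(0 : ℤ)] γ = fun τ ↦ ∑ i, ρ i j * h i τ) (τ : ℍ) :
    (serreMatrix h (γ • τ)).det =
      denom γ τ ^ (d * (d - 1)) * ((serreMatrix h τ).det * ρ.det) := by
  have h1 : serreMatrix h (γ • τ) =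
      Matrix.of fun (i j : Fin d) ↦ denom γ τ ^ (2 * (i : ℕ)) * (serreMatrix h τ * ρ) i j := by
    ext i j
    rw [Matrix.of_apply, Matrix.mul_apply, serreMatrix, Matrix.of_apply,
      serreIter_smul hmd hρ]
    rfl
  rw [h1, Matrix.det_mul_column, Matrix.det_mul, Finset.prod_pow_eq_pow_sum, ← Finset.mul_sum,
    Fin.sum_univ_eq_sum_range (fun i ↦ i), mul_comm 2, Finset.sum_range_id_mul_two]

/-- Row `i` evaluates a monic polynomial of degree `i` at the exponents, so the determinant is that
of Vandermonde. -/
lemma det_leadingMatrix_ne_zero {d : ℕ} {α : Fin d → ℂ} (hα : Function.Injective α) :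
    (Matrix.of fun i j : Fin d ↦ ∏ r ∈ Finset.range i, (α j - r / 6)).det ≠ 0 := by
  have h1 := Matrix.det_eval_matrixOfPolynomials_eq_det_vandermonde α
    (fun i ↦ ∏ r ∈ Finset.range i, (Polynomial.X - Polynomial.C (r / 6 : ℂ)))
    (fun i ↦ by rw [Polynomial.natDegree_finsetProd_X_sub_C_eq_card]; simp)
    (fun i ↦ Polynomial.monic_prod_X_sub_C _ _)
  rw [← Matrix.det_transpose]
  convert Matrix.det_vandermonde_ne_zero_iff.mpr hα using 1
  rw [h1]
  congr 1
  ext i j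
  simp [Polynomial.eval_prod]

lemma discriminant_smul (γ : SL(2, ℤ)) (τ : ℍ) :
    ModularForm.discriminant (γ • τ) = denom γ τ ^ 12 * ModularForm.discriminant τ := by
  have h := congrFun (SlashInvariantForm.slash_action_generators_SL2Z
    ModularForm.discriminant_S_invariant ModularForm.discriminant_T_invariant γ) τ
  rw [ModularForm.SL_slash_apply] at h
  rw [← h, mul_comm, mul_assoc]
  have := denom_ne_zero γ τ
  field_simp

namespace IsModularFrame

variable {d : ℕ} {h : Fin d → ℍ → ℂ} {α : Fin d → ℂ}

lemma slash_T_matrix (H : IsModularFrame h α) (j : Fin d) :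
    h j ∣[(0 : ℤ)] ModularGroup.T =
      fun τ ↦ ∑ i, (Matrix.diagonal fun j ↦ e (α j)) i j * h i τ := by
  rw [H.slash_T]
  ext τ
  rw [Finset.sum_eq_single j (fun i _ hij ↦ by simp [Matrix.diagonal_apply_ne _ hij]) (by simp)]
  simp

lemma tendsto_normalized (H : IsModularFrame h α) (n : ℕ) (j : Fin d) :
    Tendsto (fun τ : ℍ ↦ e (-α j * τ) * serreIter n (h j) τ) atImInfty
      (𝓝 (∏ r ∈ Finset.range n, (α j - r / 6))) :=
  tendsto_serreIter (H.mdiff j) (α j) (H.tendsto j) n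

lemma tendsto_normalizedMatrix (H : IsModularFrame h α) :
    Tendsto (fun τ : ℍ ↦ Matrix.of fun i j : Fin d ↦ e (-α j * τ) * serreMatrix h τ i j) atImInfty
      (𝓝 (Matrix.of fun i j : Fin d ↦ ∏ r ∈ Finset.range i, (α j - r / 6))) :=
  tendsto_pi_nhds.mpr fun i ↦ tendsto_pi_nhds.mpr fun j ↦ H.tendsto_normalized i j

lemma mdiff_det (H : IsModularFrame h α) : MDiff (fun τ ↦ (serreMatrix h τ).det) :=
  mdifferentiable_det fun _ j ↦ mdifferentiable_serreIter _ (H.mdiff j)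

/-- The weight zero quotient of the Wronskian by a power of the discriminant. -/
lemma tendsto_quotient (H : IsModularFrame h α) :
    Tendsto (fun τ : ℍ ↦ (serreMatrix h τ).det ^ 12 / ModularForm.discriminant τ ^ (d * (d - 1)))
      atImInfty
      (𝓝 ((Matrix.of fun i j : Fin d ↦ ∏ r ∈ Finset.range i, (α j - r / 6)).det ^ 12)) := by
  have h1 := ((Continuous.matrix_det continuous_id).tendsto _).comp H.tendsto_normalizedMatrix
  have h2 := (h1.pow 12).div (tendsto_e_mul_eta.pow (24 * (d * (d - 1)))) (by simp)
  simp only [one_pow, div_one] at h2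
  refine h2.congr fun τ ↦ ?_
  simp only [Function.comp_apply, Pi.div_apply, id]
  rw [Matrix.det_mul_row, mul_pow, mul_pow]
  -- The leading powers of `q` cancel exactly: `12 ∑ α j = d (d - 1)` is the order at `i∞` of the
  -- power of `Δ = η ^ 24`.
  have h3 : (∏ j, e (-α j * τ)) ^ 12 = e (-(1 / 24) * τ) ^ (24 * (d * (d - 1))) := by
    have h5 : ∀ s : Finset (Fin d), ∏ j ∈ s, e (-α j * τ) = e (-(∑ j ∈ s, α j) * τ) := by
      intro s
      induction s using Finset.induction_on with
      | empty => simp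
      | insert a s ha ih =>
        rw [Finset.prod_insert ha, Finset.sum_insert ha, ih, ← e_add]
        ring_nf
    rw [h5, e_pow, e_pow]
    congr 1
    have := H.sum_exponent
    push_cast at this ⊢
    linear_combination -(τ : ℂ) * this
  rw [h3, mul_div_mul_left _ _ (pow_ne_zero _ (e_ne_zero _)), pow_mul]
  rfl

/-- A valence argument: the order at the cusp already uses up all the zeros that the weight allows.
Concretely, `g = W ^ 12 / Δ ^ (d (d - 1))` has weight zero, `T` fixes it, and `S` multiplies it by a
sign. Hence `g ^ 2` is a modular form of weight zero, therefore constant, and its limit at `i∞` is a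
power of a nonzero Vandermonde determinant. -/
lemma det_ne_zero (H : IsModularFrame h α) (τ : ℍ) : (serreMatrix h τ).det ≠ 0 := by
  set g : ℍ → ℂ := fun τ ↦
    (serreMatrix h τ).det ^ 12 / ModularForm.discriminant τ ^ (d * (d - 1)) with hg
  set V := (Matrix.of fun i j : Fin d ↦ ∏ r ∈ Finset.range i, (α j - r / 6)).det
  have hV : V ≠ 0 := det_leadingMatrix_ne_zero H.inj
  have hlim : Tendsto g atImInfty (𝓝 (V ^ 12)) := H.tendsto_quotient
  have htrans : ∀ {ρ : Matrix (Fin d) (Fin d) ℂ} {γ : SL(2, ℤ)},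
      (∀ j, h j ∣[(0 : ℤ)] γ = fun τ ↦ ∑ i, ρ i j * h i τ) →
      ∀ τ, g (γ • τ) = ρ.det ^ 12 * g τ := by
    intro ρ γ hρ τ
    simp only [hg]
    rw [det_serreMatrix_smul H.mdiff hρ, discriminant_smul]
    have h1 := denom_ne_zero γ τ
    have h2 := ModularForm.discriminant_ne_zero τ
    rw [mul_pow, mul_pow _ _ (d * (d - 1)), ← pow_mul, ← pow_mul, mul_comm 12,
      mul_div_mul_left _ _ (pow_ne_zero _ h1)]
    ring
  obtain ⟨ρ, hρ⟩ := H.slash_S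
  have hgS := htrans hρ
  have hgT : ∀ τ, g (ModularGroup.T • τ) = g τ := by
    intro τ
    rw [htrans H.slash_T_matrix, Matrix.det_diagonal]
    have h5 : ∏ j, e (α j) = e (∑ j, α j) := by
      rw [e, Finset.mul_sum, Complex.exp_sum]
      rfl
    rw [h5, e_pow]
    have := H.sum_exponent
    push_cast at this ⊢
    rw [this]
    have := e_int ((d * (d - 1) : ℕ) : ℤ)
    push_cast at this
    rw [this, one_mul]
  -- `S` acts as an involution, so its multiplier squares to `1`, as is seen at a point near `i∞`
  -- where `g` does not vanish.
  have hsq : (ρ.det ^ 12) ^ 2 = 1 := by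
    obtain ⟨τ₀, hτ₀⟩ := (hlim.eventually_ne (pow_ne_zero 12 hV)).exists
    have h1 : ModularGroup.S • ModularGroup.S • τ₀ = τ₀ := by
      rw [UpperHalfPlane.modular_S_smul, UpperHalfPlane.modular_S_smul]
      ext
      simp
    have h2 := hgS (ModularGroup.S • τ₀)
    rw [h1, hgS] at h2
    have : ((ρ.det ^ 12) ^ 2 - 1) * g τ₀ = 0 := by linear_combination -h2
    rcases mul_eq_zero.mp this with h3 | h3
    · linear_combination h3
    · exact absurd h3 hτ₀
  have hmd : MDiff (fun τ ↦ g τ ^ 2) := by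
    refine mdifferentiable_pow (mdifferentiable_div (mdifferentiable_pow H.mdiff_det 12)
      (mdifferentiable_pow ?_ _) fun τ ↦ pow_ne_zero _ (ModularForm.discriminant_ne_zero τ)) 2
    exact mdifferentiable_pow mdifferentiable_eta 24
  have hlim2 := hlim.pow 2
  obtain ⟨F, hF⟩ := exists_modularForm_of_slash (k := 0) hmd
    (by
      ext τ
      rw [ModularForm.SL_slash_apply, hgS, mul_pow, hsq]
      simp)
    (by
      ext τ
      rw [ModularForm.SL_slash_apply, hgT]
      simp)
    (isBoundedAtImInfty_of_tendsto hlim2)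
  obtain ⟨c, hc⟩ := ModularFormClass.levelOne_weight_zero_const F
  rw [hF] at hc
  rw [hc] at hlim2
  have h6 : c = (V ^ 12) ^ 2 := tendsto_nhds_unique tendsto_const_nhds hlim2
  intro h0
  have h7 : g τ ^ 2 = c := congrFun hc τ
  simp only [hg, h0] at h7
  rw [h6] at h7
  exact pow_ne_zero 2 (pow_ne_zero 12 hV) (by simpa using h7.symm)

lemma vecMul_right_cancel {A : Matrix (Fin d) (Fin d) ℂ} {u v : Fin d → ℂ} (hA : A.det ≠ 0)
    (huv : Matrix.vecMul u A = Matrix.vecMul v A) : u = v := by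
  have := congrArg (fun w ↦ Matrix.vecMul w A⁻¹) huv
  simpa [Matrix.vecMul_vecMul, Matrix.mul_nonsing_inv _ hA.isUnit] using this

lemma vecMul_inv_apply (u : Fin d → ℂ) (A : Matrix (Fin d) (Fin d) ℂ) (i : Fin d) :
    Matrix.vecMul u A⁻¹ i = (∑ j, u j * A.adjugate j i) / A.det := by
  simp only [Matrix.vecMul, dotProduct, Matrix.inv_def, Matrix.smul_apply, smul_eq_mul,
    Ring.inverse_eq_inv']
  rw [Finset.sum_div]
  exact Finset.sum_congr rfl fun j _ ↦ by ring

/-- The lower coefficients of the monic differential equation satisfied by the frame. -/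
def _root_.AppellPDE.frameCoeff (h : Fin d → ℍ → ℂ) (τ : ℍ) : Fin d → ℂ :=
  Matrix.vecMul (fun j ↦ -serreIter d (h j) τ) (serreMatrix h τ)⁻¹

lemma vecMul_frameCoeff (H : IsModularFrame h α) (τ : ℍ) :
    Matrix.vecMul (frameCoeff h τ) (serreMatrix h τ) = fun j ↦ -serreIter d (h j) τ := by
  rw [frameCoeff, Matrix.vecMul_vecMul, Matrix.nonsing_inv_mul _ (H.det_ne_zero τ).isUnit,
    Matrix.vecMul_one]

/-- By Cramer's rule the only denominator is the Wronskian, which has no zeros. -/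
lemma mdiff_frameCoeff (H : IsModularFrame h α) (i : Fin d) :
    MDiff (fun τ ↦ frameCoeff h τ i) := by
  simp_rw [frameCoeff, vecMul_inv_apply]
  refine mdifferentiable_div (mdifferentiable_sum _ fun j _ ↦ mdifferentiable_mul ?_ ?_)
    H.mdiff_det H.det_ne_zero
  · simpa using! mdifferentiable_const_mul (-1) (mdifferentiable_serreIter d (H.mdiff j))
  · simp_rw [Matrix.adjugate_apply]
    refine mdifferentiable_det fun a b ↦ ?_
    by_cases hai : a = i
    · subst hai
      simp only [Matrix.updateRow_self]
      exact mdifferentiable_const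
    · simp only [Matrix.updateRow_ne hai]
      exact mdifferentiable_serreIter _ (H.mdiff b)

/-- The coefficients are the unique solution of a linear system that is unaffected by a change of
basis of the frame. Row `i` of the system carries weight `2 i` and the right-hand side weight `2 d`;
the difference is the weight of the coefficient. -/
lemma frameCoeff_slash (H : IsModularFrame h α) {ρ : Matrix (Fin d) (Fin d) ℂ} {γ : SL(2, ℤ)}
    (hρ : ∀ j, h j ∣[(0 : ℤ)] γ = fun τ ↦ ∑ i, ρ i j * h i τ) (i : Fin d) :
    (fun τ ↦ frameCoeff h τ i) ∣[((2 * d - 2 * (i : ℕ) : ℕ) : ℤ)] γ =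
      fun τ ↦ frameCoeff h τ i := by
  ext τ
  have hden := denom_ne_zero γ τ
  have hdet : (serreMatrix h τ * ρ).det ≠ 0 := by
    have := H.det_ne_zero (γ • τ)
    rw [det_serreMatrix_smul H.mdiff hρ] at this
    rw [Matrix.det_mul]
    exact right_ne_zero_of_mul this
  have h1 : (fun i : Fin d ↦ frameCoeff h (γ • τ) i * denom γ τ ^ (2 * (i : ℕ))) =
      fun i : Fin d ↦ frameCoeff h τ i * denom γ τ ^ (2 * d) := by
    refine vecMul_right_cancel hdet ?_
    have h2 : Matrix.vecMul
        (fun i : Fin d ↦ frameCoeff h (γ • τ) i * denom γ τ ^ (2 * (i : ℕ)))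
        (serreMatrix h τ * ρ) = Matrix.vecMul (frameCoeff h (γ • τ)) (serreMatrix h (γ • τ)) := by
      ext j
      simp only [Matrix.vecMul, dotProduct]
      refine Finset.sum_congr rfl fun i _ ↦ ?_
      rw [serreMatrix, serreMatrix, Matrix.of_apply, serreIter_smul H.mdiff hρ,
        Matrix.mul_apply]
      simp only [Matrix.of_apply]
      ring
    have h3 : (fun i : Fin d ↦ frameCoeff h τ i * denom γ τ ^ (2 * d)) =
        denom γ τ ^ (2 * d) • frameCoeff h τ := by
      ext i
      simp [mul_comm]
    rw [h2, H.vecMul_frameCoeff, h3, Matrix.smul_vecMul, ← Matrix.vecMul_vecMul,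
      H.vecMul_frameCoeff]
    ext j
    rw [serreIter_smul H.mdiff hρ, Pi.smul_apply, smul_eq_mul, ← mul_neg]
    simp [Matrix.vecMul, dotProduct]
  have h2 := congrFun h1 i
  have hle : 2 * (i : ℕ) ≤ 2 * d := by omega
  rw [ModularForm.SL_slash_apply, zpow_neg, zpow_natCast, ← div_eq_mul_inv,
    div_eq_iff (pow_ne_zero _ hden)]
  refine mul_right_cancel₀ (pow_ne_zero (2 * (i : ℕ)) hden) (h2.trans ?_)
  rw [mul_assoc, ← pow_add, Nat.sub_add_cancel hle]

/-- Scaling the `j`-th equation by `q ^ (-α j)` leaves the solution unchanged, and the scaled system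
converges at `i∞` to an invertible one. -/
lemma isBounded_frameCoeff (H : IsModularFrame h α) (i : Fin d) :
    IsBoundedAtImInfty fun τ ↦ frameCoeff h τ i := by
  have hN := H.tendsto_normalizedMatrix
  set N : ℍ → Matrix (Fin d) (Fin d) ℂ :=
    fun τ ↦ Matrix.of fun i j : Fin d ↦ e (-α j * τ) * serreMatrix h τ i j with hNdef
  have hdetN : ∀ τ, (N τ).det ≠ 0 := by
    intro τ
    rw [hNdef, Matrix.det_mul_row]
    exact mul_ne_zero (Finset.prod_ne_zero_iff.mpr fun j _ ↦ e_ne_zero _) (H.det_ne_zero τ)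
  have h1 : ∀ τ, frameCoeff h τ =
      Matrix.vecMul (fun j ↦ -(e (-α j * τ) * serreIter d (h j) τ)) (N τ)⁻¹ := by
    intro τ
    refine vecMul_right_cancel (hdetN τ) ?_
    rw [Matrix.vecMul_vecMul _ _ (N τ), Matrix.nonsing_inv_mul _ (hdetN τ).isUnit,
      Matrix.vecMul_one]
    ext j
    have h3 := congrFun (H.vecMul_frameCoeff τ) j
    simp only [Matrix.vecMul, dotProduct] at h3 ⊢
    rw [neg_mul_eq_mul_neg, ← h3, Finset.mul_sum]
    refine Finset.sum_congr rfl fun i _ ↦ ?_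
    simp only [hNdef, Matrix.of_apply]
    ring
  have h2 : (fun τ ↦ frameCoeff h τ i) = fun τ : ℍ ↦
      (∑ j, -(e (-α j * τ) * serreIter d (h j) τ) * (N τ).adjugate j i) / (N τ).det := by
    ext τ
    rw [h1, vecMul_inv_apply]
  rw [h2]
  have hdetlim := ((Continuous.matrix_det continuous_id).tendsto _).comp hN
  have hadj := ((Continuous.matrix_adjugate continuous_id).tendsto _).comp hN
  exact isBoundedAtImInfty_of_tendsto ((tendsto_finsetSum _ fun j _ ↦
    ((H.tendsto_normalized d j).neg.mul
      (tendsto_pi_nhds.mp (tendsto_pi_nhds.mp hadj j) i))).div hdetlim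
    (det_leadingMatrix_ne_zero H.inj))

/-- The functions of a modular frame satisfy a monic modular differential equation. -/
theorem exists_modularForm_sum_eq_zero (H : IsModularFrame h α) :
    ∃ F : (j : ℕ) → ModularForm 𝒮ℒ (j : ℤ), (∀ τ, F 0 τ = 1) ∧
      ∀ j τ, ∑ k ∈ Finset.range (d + 1), F (2 * d - 2 * k) τ * serreIter k (h j) τ = 0 := by
  obtain ⟨ρ, hρ⟩ := H.slash_S
  choose X hX using fun i ↦ exists_modularForm_of_slash (H.mdiff_frameCoeff i)
    (H.frameCoeff_slash hρ i) (H.frameCoeff_slash H.slash_T_matrix i) (H.isBounded_frameCoeff i)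
  -- The family is indexed by all weights: `1` in weight `0`, zero in weights that do not occur.
  -- Weight `0` never collides with some `2 d - 2 i`, as `i < d`.
  have hex : ∀ n : ℕ, ∃ F : ModularForm 𝒮ℒ (n : ℤ), (n = 0 → ∀ τ, F τ = 1) ∧
      ∀ i : Fin d, n = 2 * d - 2 * (i : ℕ) → ∀ τ, F τ = frameCoeff h τ i := by
    intro n
    rcases Nat.eq_zero_or_pos n with rfl | hn
    · exact ⟨ModularForm.const 1, fun _ τ ↦ rfl, fun i hi ↦ by omega⟩
    · by_cases hi : ∃ i : Fin d, n = 2 * d - 2 * (i : ℕ)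
      · obtain ⟨i, rfl⟩ := hi
        refine ⟨X i, fun h ↦ by omega, fun i' hi' τ ↦ ?_⟩
        have : i = i' := by omega
        rw [hX, this]
      · exact ⟨0, fun h ↦ by omega, fun i hi' ↦ absurd ⟨i, hi'⟩ hi⟩
  choose F hF0 hF using hex
  refine ⟨F, hF0 0 rfl, fun j τ ↦ ?_⟩
  have h1 := congrFun (H.vecMul_frameCoeff τ) j
  simp only [Matrix.vecMul, dotProduct, serreMatrix, Matrix.of_apply] at h1
  rw [Finset.sum_range_succ, Nat.sub_self, hF0 0 rfl, one_mul,
    Finset.sum_range (fun k ↦ F (2 * d - 2 * k) τ * serreIter k (h j) τ)]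
  simp_rw [fun i : Fin d ↦ hF (2 * d - 2 * (i : ℕ)) i rfl τ]
  rw [h1]
  ring

end IsModularFrame

/-! ### Termwise differentiation and unary theta series -/

/-- For holomorphic summands a uniform summable bound on the terms themselves is enough, since
locally uniform convergence passes to derivatives. -/
lemma hasDerivAt_tsum_of_norm_le {ι : Type*} {f : ι → ℂ → ℂ} {z : ℂ} {u : ι → ℝ} (hu : Summable u)
    {V : Set ℂ} (hV : V ∈ 𝓝 z) (hf : ∀ i, ∀ w ∈ V, DifferentiableAt ℂ (f i) w)
    (hb : ∀ i, ∀ w ∈ V, ‖f i w‖ ≤ u i) :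
    HasDerivAt (fun w ↦ ∑' i, f i w) (∑' i, deriv (f i) z) z := by
  obtain ⟨U, hUV, hU, hz⟩ := mem_nhds_iff.mp hV
  have hd : ∀ i, DifferentiableOn ℂ (f i) U :=
    fun i w hw ↦ (hf i w (hUV hw)).differentiableWithinAt
  have h1 := Complex.hasSum_deriv_of_summable_norm hu hd hU (fun i w hw ↦ hb i w (hUV hw)) hz
  rw [h1.tsum_eq]
  exact ((Complex.differentiableOn_tsum_of_summable_norm hu hd hU
    fun i w hw ↦ hb i w (hUV hw)).differentiableAt (hU.mem_nhds hz)).hasDerivAt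

lemma hasSum_iteratedDeriv_two_of_norm_le {ι : Type*} {f : ι → ℂ → ℂ} {z : ℂ} {u : ι → ℝ}
    (hu : Summable u) {V : Set ℂ} (hV : V ∈ 𝓝 z)
    (hf : ∀ i, ∀ w ∈ V, DifferentiableAt ℂ (f i) w) (hb : ∀ i, ∀ w ∈ V, ‖f i w‖ ≤ u i) :
    HasSum (fun i ↦ iteratedDeriv 2 (f i) z) (iteratedDeriv 2 (fun w ↦ ∑' i, f i w) z) := by
  obtain ⟨U, hUV, hU, hz⟩ := mem_nhds_iff.mp hV
  have hd : ∀ i, DifferentiableOn ℂ (f i) U :=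
    fun i w hw ↦ (hf i w (hUV hw)).differentiableWithinAt
  have h0 : TendstoLocallyUniformlyOn (fun (s : Finset ι) w ↦ ∑ i ∈ s, f i w)
      (fun w ↦ ∑' i, f i w) atTop U :=
    (tendstoUniformlyOn_tsum hu fun i w hw ↦ hb i w (hUV hw)).tendstoLocallyUniformlyOn
  have hds : ∀ s : Finset ι, DifferentiableOn ℂ (fun w ↦ ∑ i ∈ s, f i w) U :=
    fun s ↦ DifferentiableOn.fun_sum fun i _ ↦ hd i
  have h1 := h0.deriv (Eventually.of_forall hds) hU
  have h2 := h1.deriv (Eventually.of_forall fun s ↦ (hds s).deriv hU) hU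
  have h3 := h2.tendsto_at hz
  rw [HasSum, SummationFilter.unconditional_filter]
  have h4 : ∀ g : ℂ → ℂ, iteratedDeriv 2 g = deriv (deriv g) := fun g ↦ by
    rw [iteratedDeriv_succ, iteratedDeriv_one]
  rw [h4]
  refine h3.congr fun s ↦ ?_
  simp only [Function.comp_apply]
  rw [← h4, iteratedDeriv_fun_sum]
  exact fun i _ ↦ ((hd i).contDiffOn hU).contDiffAt (hU.mem_nhds hz)

lemma summable_exp_neg_sq_add (b : ℝ) {a : ℝ} (ha : 0 < a) :
    Summable fun n : ℤ ↦ Real.exp (-a * n ^ 2 + b * |(n : ℝ)|) := by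
  have h := summable_pow_mul_jacobiTheta₂_term_bound (b / (2 * π)) (div_pos ha Real.pi_pos) 0
  refine h.congr fun n ↦ ?_
  have := Real.pi_ne_zero
  rw [pow_zero, one_mul]
  congr 1
  push_cast
  field_simp
  ring

/-- Summand of `thetaSum`. -/
def thetaTerm (l k : ℕ) (a : ℝ) (m : ℤ) (τ : ℂ) : ℂ :=
  (-1) ^ m * (l * m + a) ^ (2 * k) * e ((l * m + a) ^ 2 / (2 * l) * τ)

/-- Partial theta-type series `∑ (-1) ^ m (l m + a) ^ (2 k) q ^ ((l m + a) ^ 2 / (2 l))`. -/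
def thetaSum (l k : ℕ) (a : ℝ) (τ : ℂ) : ℂ := ∑' m : ℤ, thetaTerm l k a m τ

lemma norm_neg_one_zpow (m : ℤ) : ‖(-1 : ℂ) ^ m‖ = 1 := by simp

lemma norm_e_ofReal_mul (x : ℝ) (τ : ℂ) : ‖e (x * τ)‖ = Real.exp (-2 * π * x * τ.im) := by
  rw [norm_e]
  simp [mul_assoc]

lemma norm_thetaTerm_le {l : ℕ} (hl : 0 < l) (k : ℕ) (a : ℝ) (m : ℤ) {τ : ℂ} {y : ℝ} (hy : 0 < y)
    (hτ : y ≤ τ.im) : ‖thetaTerm l k a m τ‖ ≤ (2 * k).factorial * Real.exp |a| *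
      Real.exp (-(π * y * l) * m ^ 2 + (l + 2 * π * y * |a|) * |(m : ℝ)|) := by
  have hl' : (0 : ℝ) < l := by exact_mod_cast hl
  have h1 : thetaTerm l k a m τ = (-1) ^ m * (((l * m + a : ℝ)) : ℂ) ^ (2 * k) *
      e ((((l * m + a) ^ 2 / (2 * l) : ℝ) : ℂ) * τ) := by
    simp [thetaTerm]
  rw [h1, norm_mul, norm_mul, norm_neg_one_zpow, one_mul, norm_e_ofReal_mul, norm_pow,
    Complex.norm_real, Real.norm_eq_abs]
  have h2 : |(l * m + a : ℝ)| ≤ l * |(m : ℝ)| + |a| := by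
    refine (abs_add_le _ _).trans ?_
    rw [abs_mul, abs_of_pos hl']
  -- The polynomial factor is absorbed through `x ^ (2 k) ≤ (2 k)! exp x`, at the cost of a term
  -- linear in `|m|` in the exponent.
  have h3 := Real.pow_div_factorial_le_exp _ (abs_nonneg (l * m + a : ℝ)) (2 * k)
  rw [div_le_iff₀ (by positivity)] at h3
  have h4 : |(l * m + a : ℝ)| ^ (2 * k) ≤
      (2 * k).factorial * Real.exp |a| * Real.exp (l * |(m : ℝ)|) := by
    refine h3.trans ?_
    rw [mul_comm, mul_assoc, ← Real.exp_add]
    gcongr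
    linarith
  have h5 : (l : ℝ) * m ^ 2 - 2 * |a| * |(m : ℝ)| ≤ (l * m + a) ^ 2 / l := by
    rw [le_div_iff₀ hl']
    have : -(|a| * |(m : ℝ)|) ≤ a * m := by
      rw [← abs_mul]
      exact neg_abs_le _
    nlinarith [sq_nonneg a]
  have h6 : Real.exp (-2 * π * ((l * m + a) ^ 2 / (2 * l)) * τ.im) ≤
      Real.exp (-π * y * (l * m ^ 2 - 2 * |a| * |(m : ℝ)|)) := by
    rw [Real.exp_le_exp]
    have h7 : 0 ≤ (l * m + a) ^ 2 / (l : ℝ) := by positivity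
    have h8 : (l * m + a) ^ 2 / (l : ℝ) * y ≤ (l * m + a) ^ 2 / (l : ℝ) * τ.im := by gcongr
    have h9 : ((l : ℝ) * m ^ 2 - 2 * |a| * |(m : ℝ)|) * y ≤ (l * m + a) ^ 2 / l * y := by gcongr
    have h10 : -2 * π * ((l * m + a) ^ 2 / (2 * l)) * τ.im =
        -π * ((l * m + a) ^ 2 / (l : ℝ) * τ.im) := by
      field_simp
    rw [h10]
    nlinarith [Real.pi_pos]
  calc _ ≤ ((2 * k).factorial * Real.exp |a| * Real.exp (l * |(m : ℝ)|)) *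
        Real.exp (-π * y * (l * m ^ 2 - 2 * |a| * |(m : ℝ)|)) := by gcongr
    _ = _ := by
      rw [mul_assoc, ← Real.exp_add]
      congr 2
      ring

lemma summable_thetaTerm_bound {l : ℕ} (hl : 0 < l) (k : ℕ) (a : ℝ) {y : ℝ} (hy : 0 < y) :
    Summable fun m : ℤ ↦ ((2 * k).factorial * Real.exp |a| *
      Real.exp (-(π * y * l) * m ^ 2 + (l + 2 * π * y * |a|) * |(m : ℝ)|)) := by
  have hl' : (0 : ℝ) < l := by exact_mod_cast hl
  exact (summable_exp_neg_sq_add _ (by have := Real.pi_pos; positivity)).mul_left _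

lemma hasSum_thetaTerm {l : ℕ} (hl : 0 < l) (k : ℕ) (a : ℝ) {τ : ℂ} (hτ : 0 < τ.im) :
    HasSum (fun m ↦ thetaTerm l k a m τ) (thetaSum l k a τ) :=
  ((summable_thetaTerm_bound hl k a hτ).of_norm_bounded
    fun m ↦ norm_thetaTerm_le hl k a m hτ le_rfl).hasSum

lemma hasDerivAt_e_const_mul (c z : ℂ) :
    HasDerivAt (fun z ↦ e (c * z)) (2 * π * Complex.I * c * e (c * z)) z := by
  have : HasDerivAt (fun z : ℂ ↦ e (c * z)) (e (c * z) * (2 * π * Complex.I * (c * 1))) z := by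
    unfold e
    exact (((hasDerivAt_id z).const_mul c).const_mul _).cexp
  convert this using 1
  ring

lemma hasDerivAt_thetaSum {l : ℕ} (hl : 0 < l) (k : ℕ) (a : ℝ) {τ : ℂ} (hτ : 0 < τ.im) :
    HasDerivAt (thetaSum l k a) (2 * π * Complex.I / (2 * l) * thetaSum l (k + 1) a τ) τ := by
  have hl' : (l : ℂ) ≠ 0 := by exact_mod_cast hl.ne'
  have hterm : ∀ m : ℤ, ∀ z : ℂ, HasDerivAt (thetaTerm l k a m)
      (2 * π * Complex.I / (2 * l) * thetaTerm l (k + 1) a m z) z := by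
    intro m z
    refine ((hasDerivAt_e_const_mul ((l * m + a) ^ 2 / (2 * l)) z).const_mul
      ((-1) ^ m * (l * m + a : ℂ) ^ (2 * k))).congr_deriv ?_
    unfold thetaTerm
    ring
  have h := hasDerivAt_tsum_of_norm_le (summable_thetaTerm_bound hl k a (half_pos hτ))
    (V := {z | τ.im / 2 < z.im})
    ((isOpen_lt continuous_const Complex.continuous_im).mem_nhds (by
      change τ.im / 2 < τ.im
      linarith))
    (fun m z _ ↦ (hterm m z).differentiableAt)
    (fun m z hz ↦ norm_thetaTerm_le hl k a m (half_pos hτ) (le_of_lt hz))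
  refine h.congr_deriv ?_
  unfold thetaSum
  rw [← tsum_mul_left]
  exact tsum_congr fun m ↦ (hterm m τ).deriv

lemma mdifferentiable_thetaSum {l : ℕ} (hl : 0 < l) (k : ℕ) (a : ℝ) :
    MDiff (fun τ : ℍ ↦ thetaSum l k a τ) :=
  mdifferentiable_of_differentiableAt fun _ hz ↦ (hasDerivAt_thetaSum hl k a hz).differentiableAt

lemma normalizedDeriv_thetaSum {l : ℕ} (hl : 0 < l) (k : ℕ) (a : ℝ) (τ : ℍ) :
    2 * l * normalizedDerivOfComplex (fun τ : ℍ ↦ thetaSum l k a τ) τ =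
      thetaSum l (k + 1) a τ := by
  rw [normalizedDeriv_eq_of_hasDerivAt τ (hasDerivAt_thetaSum hl k a τ.2)]
  have hl' : (l : ℂ) ≠ 0 := by exact_mod_cast hl.ne'
  have : (π : ℂ) ≠ 0 := by exact_mod_cast Real.pi_ne_zero
  change 2 * (l : ℂ) * ((2 * π * Complex.I)⁻¹ *
    (2 * π * Complex.I / (2 * l) * thetaSum l (k + 1) a τ)) = _
  field_simp

lemma thetaSum_neg (l k : ℕ) (a : ℝ) (τ : ℂ) : thetaSum l k (-a) τ = thetaSum l k a τ := by
  rw [thetaSum, thetaSum, ← (Equiv.neg ℤ).tsum_eq]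
  refine tsum_congr fun m ↦ ?_
  have h1 : (l * ((-m : ℤ) : ℂ) + ((-a : ℝ) : ℂ)) = -(l * m + a) := by push_cast; ring
  simp only [thetaTerm, Equiv.neg_apply, h1, zpow_neg]
  rw [(even_two_mul k).neg_pow, neg_sq]
  congr 2
  rw [← inv_zpow]
  norm_num

/-- The reflection `m ↦ 1 - m` negates `l m - l / 2` and flips the sign `(-1) ^ m`, so the series
equals its own negative. -/
lemma thetaSum_neg_half (l k : ℕ) (τ : ℂ) : thetaSum l k (-(l / 2)) τ = 0 := by
  have h : thetaSum l k (-(l / 2)) τ = -thetaSum l k (-(l / 2)) τ := by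
    conv_lhs => rw [thetaSum, ← (Equiv.subLeft (1 : ℤ)).tsum_eq]
    rw [thetaSum, ← tsum_neg]
    refine tsum_congr fun m ↦ ?_
    have h1 : (l * ((1 - m : ℤ) : ℂ) + ((-(l / 2) : ℝ) : ℂ)) = -(l * m + ((-(l / 2) : ℝ) : ℂ)) := by
      push_cast; ring
    simp only [thetaTerm, Equiv.subLeft_apply, h1]
    rw [(even_two_mul k).neg_pow, neg_sq, zpow_sub₀ (by norm_num)]
    have : ((-1 : ℂ) ^ m)⁻¹ = (-1) ^ m := by
      rw [← inv_zpow]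
      norm_num
    rw [div_eq_mul_inv, this]
    ring
  linear_combination h / 2

/-- The `l` theta series with characteristic in `ℤ + 1 / 2` modulo `l` reduce to `(l - 1) / 2`
of them. -/
lemma thetaSum_fold (d : ℕ) {j : ℕ} (hj : j < 2 * d + 1) :
    (∀ k τ, thetaSum (2 * d + 1) k (j - ((2 * d + 1 : ℕ) : ℝ) / 2) τ = 0) ∨
    ∃ i : Fin d, ∀ k τ, thetaSum (2 * d + 1) k (j - ((2 * d + 1 : ℕ) : ℝ) / 2) τ =
      thetaSum (2 * d + 1) k (i + 1 / 2) τ := by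
  rcases Nat.eq_zero_or_pos j with rfl | hj0
  · left
    intro k τ
    rw [← thetaSum_neg_half (2 * d + 1) k τ]
    congr 1
    push_cast
    ring
  · right
    -- For `1 ≤ j ≤ d` the characteristic is `-(d - j + 1 / 2)` and the symmetry in `a` applies; for
    -- `j > d` it is already `(j - d - 1) + 1 / 2`.
    rcases le_or_gt j d with h | h
    · refine ⟨⟨d - j, by omega⟩, fun k τ ↦ ?_⟩
      rw [← thetaSum_neg]
      congr 1
      push_cast [Nat.cast_sub h]
      ring
    · refine ⟨⟨j - d - 1, by omega⟩, fun k τ ↦ ?_⟩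
      congr 1
      have : j = (j - d - 1) + d + 1 := by omega
      have h2 : (j : ℝ) = ((j - d - 1 : ℕ) : ℝ) + d + 1 := by exact_mod_cast this
      push_cast
      rw [h2]
      ring

lemma thetaSum_add_one (d i : ℕ) (τ : ℂ) :
    thetaSum (2 * d + 1) 0 (i + 1 / 2) (τ + 1) =
      e ((i + 1 / 2) ^ 2 / (2 * (2 * d + 1 : ℕ))) * thetaSum (2 * d + 1) 0 (i + 1 / 2) τ := by
  rw [thetaSum, thetaSum, ← tsum_mul_left]
  refine tsum_congr fun m ↦ ?_
  -- The exponents of `q` differ from the one at `m = 0` by half of this product. It is even because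
  -- `l` is odd, so all terms acquire the same root of unity under `τ ↦ τ + 1`.
  obtain ⟨c, hc⟩ : ∃ c : ℤ, m * ((2 * d + 1) * m + 2 * i + 1) = 2 * c := by
    have : Even (m * ((2 * d + 1) * m + 2 * i + 1)) := by
      rcases Int.even_or_odd m with h | h
      · exact h.mul_right _
      · refine Even.mul_left ?_ m
        obtain ⟨r, rfl⟩ := h
        exact ⟨(2 * d + 1) * r + d + i + 1, by ring⟩
    obtain ⟨c, hc⟩ := this
    exact ⟨c, by rw [hc]; ring⟩
  have hc' : (m : ℂ) * ((2 * d + 1) * m + 2 * i + 1) = 2 * c := by exact_mod_cast hc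
  have hd : (2 * (d : ℂ) + 1) ≠ 0 := by exact_mod_cast (by omega : 2 * d + 1 ≠ 0)
  simp only [thetaTerm]
  have h1 : e ((((2 * d + 1 : ℕ) : ℂ) * m + ((i + 1 / 2 : ℝ) : ℂ)) ^ 2 /
      (2 * ((2 * d + 1 : ℕ) : ℂ)) * (τ + 1)) = e ((i + 1 / 2) ^ 2 / (2 * (2 * d + 1 : ℕ))) *
      e ((((2 * d + 1 : ℕ) : ℂ) * m + ((i + 1 / 2 : ℝ) : ℂ)) ^ 2 /
      (2 * ((2 * d + 1 : ℕ) : ℂ)) * τ) := by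
    rw [mul_add, mul_one, e_add, mul_comm]
    congr 1
    have : (((2 * d + 1 : ℕ) : ℂ) * m + ((i + 1 / 2 : ℝ) : ℂ)) ^ 2 /
      (2 * ((2 * d + 1 : ℕ) : ℂ)) = (i + 1 / 2) ^ 2 / (2 * (2 * d + 1 : ℕ)) + c := by
      push_cast
      field_simp
      linear_combination (4 * (2 * (d : ℂ) + 1)) * hc'
    rw [this, e_add, e_int, mul_one]
  rw [h1]
  ring

lemma neg_one_zpow_eq_e (m : ℤ) : (-1 : ℂ) ^ m = e (m / 2) := by
  have h : (-1 : ℂ) = Complex.exp (π * Complex.I) := Complex.exp_pi_mul_I.symm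
  rw [h, ← Complex.exp_int_mul, e]
  congr 1
  ring

lemma e_eq_e_of_sub_eq_int {x y : ℂ} (n : ℤ) (h : x = y + n) : e x = e y := by
  rw [h, e_add, e_int, mul_one]

lemma jacobiTheta₂_term_eq_e (n : ℤ) (z τ : ℂ) :
    jacobiTheta₂_term n z τ = e (n * z + n ^ 2 / 2 * τ) := by
  rw [jacobiTheta₂_term, e]
  congr 1
  ring

lemma thetaSum_eq_jacobiTheta₂ {l : ℕ} (hl : 0 < l) (a : ℝ) (τ : ℂ) :
    thetaSum l 0 a τ = e (a ^ 2 / (2 * l) * τ) * jacobiTheta₂ (1 / 2 + a * τ) (l * τ) := by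
  have hl' : (l : ℂ) ≠ 0 := by exact_mod_cast hl.ne'
  rw [thetaSum, jacobiTheta₂, ← tsum_mul_left]
  refine tsum_congr fun m ↦ ?_
  rw [jacobiTheta₂_term_eq_e, thetaTerm, neg_one_zpow_eq_e, mul_zero, pow_zero, mul_one, ← e_add,
    ← e_add]
  congr 1
  field_simp
  ring

lemma log_I_mul_div {τ : ℂ} (hτ : 0 < τ.im) {r : ℝ} (hr : 0 < r) :
    Complex.log (Complex.I * (r / τ)) = Real.log r + Complex.log Complex.I - Complex.log τ := by
  have h0 : τ ≠ 0 := by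
    rintro rfl
    simp at hτ
  have h1 : 0 < τ.arg := by
    rcases (Complex.arg_nonneg_iff.mpr hτ.le).lt_or_eq with h | h
    · exact h
    · have := Complex.arg_eq_zero_iff.mp h.symm
      exact absurd this.2 hτ.ne'
  have h2 : τ.arg ≠ π := fun h ↦ hτ.ne' (Complex.arg_eq_pi_iff.mp h).2
  have h3 : Complex.I * (r / τ) = r * (Complex.I * τ⁻¹) := by
    rw [div_eq_mul_inv]
    ring
  rw [h3, Complex.log_ofReal_mul hr (mul_ne_zero Complex.I_ne_zero (inv_ne_zero h0)),
    (Complex.log_mul_eq_add_log_iff Complex.I_ne_zero (inv_ne_zero h0)).mpr, Complex.log_inv _ h2]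
  · ring
  · rw [Complex.arg_inv, if_neg h2, Complex.arg_I]
    have := Complex.arg_le_pi τ
    constructor <;> linarith [Real.pi_pos]

/-- Reconciles two branches: the inversion of `jacobiTheta₂` yields the power on the left, that of
`η` yields `Complex.sqrt τ`. In the quotient of theta by eta only a constant must survive. -/
lemma cpow_half_I_mul_div {τ : ℂ} (hτ : 0 < τ.im) {r : ℝ} (hr : 0 < r) :
    (Complex.I * (r / τ)) ^ (1 / 2 : ℂ) * Complex.sqrt τ =
      Complex.exp (Real.log r / 2) * Complex.sqrt Complex.I := by
  have h0 : τ ≠ 0 := by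
    rintro rfl
    simp at hτ
  have h1 : Complex.I * (r / τ) ≠ 0 :=
    mul_ne_zero Complex.I_ne_zero (div_ne_zero (by exact_mod_cast hr.ne') h0)
  rw [Complex.cpow_def_of_ne_zero h1, log_I_mul_div hτ hr, Complex.sqrt, Complex.sqrt,
    Complex.cpow_def_of_ne_zero h0, Complex.cpow_def_of_ne_zero Complex.I_ne_zero,
    ← Complex.exp_add, ← Complex.exp_add]
  congr 1
  ring

lemma sqrt_ne_zero' {τ : ℂ} (h : τ ≠ 0) : Complex.sqrt τ ≠ 0 := by
  rw [Complex.sqrt, Complex.cpow_def_of_ne_zero h]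
  exact Complex.exp_ne_zero _

lemma tsum_int_eq_sum_tsum_residue {f : ℤ → ℂ} (hf : Summable f) (l : ℕ) [NeZero l] (d : ℤ) :
    ∑' n, f n = ∑ j : Fin l, ∑' m : ℤ, f (l * m + j - d) := by
  set E : Fin l × ℤ ≃ ℤ :=
    ((Equiv.prodComm _ _).trans (Int.divModEquiv l).symm).trans (Equiv.subRight d) with hE
  rw [← E.tsum_eq, Summable.tsum_prod (f := fun p ↦ f (E p)) ((E.summable_iff).mpr hf),
    tsum_fintype]
  refine Finset.sum_congr rfl fun j _ ↦ tsum_congr fun m ↦ ?_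
  congr 1
  change m * (l : ℤ) + (j : ℤ) - d = _
  ring

/-- Jacobi inversion turns the modulus `-l / τ` into `τ / l`; splitting the summation index by
residues modulo `l` restores theta series of level `l`. -/
lemma thetaSum_neg_inv (d i : ℕ) {τ : ℂ} (hτ : 0 < τ.im) :
    thetaSum (2 * d + 1) 0 (i + 1 / 2) (-1 / τ) =
      Complex.sqrt τ / (Complex.exp (Real.log (2 * d + 1 : ℕ) / 2) * Complex.sqrt Complex.I) *
      ∑ j : Fin (2 * d + 1),
        e ((i + 1 / 2) * (j - ((2 * d + 1 : ℕ) : ℂ) / 2) / (2 * d + 1 : ℕ)) *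
          thetaSum (2 * d + 1) 0 (j - ((2 * d + 1 : ℕ) : ℝ) / 2) τ := by
  set l : ℕ := 2 * d + 1 with hl
  have hl0 : 0 < l := by omega
  have hlR : (0 : ℝ) < l := by exact_mod_cast hl0
  have hlC : (l : ℂ) ≠ 0 := by exact_mod_cast hl0.ne'
  have h0 : τ ≠ 0 := by
    rintro rfl
    simp at hτ
  set a : ℝ := i + 1 / 2 with ha
  have haC : (a : ℂ) = i + 1 / 2 := by rw [ha]; push_cast; ring
  rw [thetaSum_eq_jacobiTheta₂ hl0, jacobiTheta₂_functional_equation]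
  have h1 : (1 / 2 + a * (-1 / τ)) / (l * (-1 / τ)) = a / l - τ / (2 * l) := by
    field_simp
    ring
  have h2 : -1 / (l * (-1 / τ)) = τ / l := by
    field_simp
  have h3 : -Complex.I * (l * (-1 / τ)) = Complex.I * ((l : ℝ) / τ) := by
    push_cast
    ring
  have h4 : Complex.exp (-π * Complex.I * (1 / 2 + a * (-1 / τ)) ^ 2 / (l * (-1 / τ))) =
      e (τ / (8 * l) - a / (2 * l) + a ^ 2 / (2 * l * τ)) := by
    rw [e]
    congr 1
    field_simp
    ring
  rw [h1, h2, h3, h4]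
  have h5 := cpow_half_I_mul_div hτ hlR
  have h6 : (Complex.I * ((l : ℝ) / τ)) ^ (1 / 2 : ℂ) ≠ 0 := by
    intro h
    rw [h, zero_mul] at h5
    exact mul_ne_zero (Complex.exp_ne_zero _) (sqrt_ne_zero' Complex.I_ne_zero) h5.symm
  have h7 : 1 / (Complex.I * ((l : ℝ) / τ)) ^ (1 / 2 : ℂ) =
      Complex.sqrt τ / (Complex.exp (Real.log l / 2) * Complex.sqrt Complex.I) := by
    rw [← h5]
    have := sqrt_ne_zero' h0
    field_simp
  have hτl : 0 < (τ / l).im := by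
    have : (τ / l).im = τ.im / l := by
      rw [show (l : ℂ) = ((l : ℝ) : ℂ) by push_cast; rfl, Complex.div_ofReal_im]
    rw [this]
    positivity
  have h8 : e (τ / (8 * l) - a / (2 * l)) * jacobiTheta₂ (a / l - τ / (2 * l)) (τ / l) =
      ∑ j : Fin l, e ((i + 1 / 2) * (j - (l : ℂ) / 2) / l) * thetaSum l 0 (j - (l : ℝ) / 2) τ := by
    -- The shift by `d` makes `n - 1 / 2 = l m + (j - l / 2)` for `n = l m + j - d`, which is the
    -- characteristic wanted.
    rw [jacobiTheta₂, tsum_int_eq_sum_tsum_residue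
      ((summable_jacobiTheta₂_term_iff _ _).mpr hτl) l (d : ℤ), Finset.mul_sum]
    refine Finset.sum_congr rfl fun j _ ↦ ?_
    rw [thetaSum, ← tsum_mul_left, ← tsum_mul_left]
    refine tsum_congr fun m ↦ ?_
    rw [jacobiTheta₂_term_eq_e, thetaTerm, neg_one_zpow_eq_e, mul_zero, pow_zero, mul_one,
      ← e_add, ← e_add, ← e_add]
    refine e_eq_e_of_sub_eq_int (i * m) ?_
    have hd : (d : ℂ) = (l - 1) / 2 := by
      rw [hl]
      push_cast
      ring
    push_cast
    rw [haC, hd]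
    field_simp
    ring
  rw [h7, ← h8]
  have h9 : e (a ^ 2 / (2 * l) * (-1 / τ)) *
      e (τ / (8 * l) - a / (2 * l) + a ^ 2 / (2 * l * τ)) = e (τ / (8 * l) - a / (2 * l)) := by
    rw [← e_add]
    congr 1
    field_simp
    ring
  rw [← h9]
  push_cast
  ring

/-! ### Theta quotients form a modular frame -/

/-- Theta series divided by the eta function, of weight zero. -/
def thetaQuot (d : ℕ) (i : Fin d) (τ : ℍ) : ℂ :=
  thetaSum (2 * d + 1) 0 (i + 1 / 2) τ / ModularForm.eta τ

lemma mdifferentiable_thetaQuot (d : ℕ) (i : Fin d) : MDiff (thetaQuot d i) :=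
  mdifferentiable_div (mdifferentiable_thetaSum (by omega) _ _) mdifferentiable_eta
    fun τ ↦ ModularForm.eta_ne_zero τ.2

lemma eta_add_one (τ : ℂ) : ModularForm.eta (τ + 1) = e (1 / 24) * ModularForm.eta τ := by
  have h1 : ∀ z : ℂ, ModularForm.eta z = e (z / 24) * ∏' n : ℕ, (1 - e z ^ (n + 1)) := by
    intro z
    rw [ModularForm.eta]
    have : Function.Periodic.qParam 24 z = e (z / 24) := by
      rw [e, Function.Periodic.qParam]
      push_cast
      congr 1
      ring
    rw [this]
    simp_rw [ModularForm.eta_q_eq_pow]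
    rfl
  have h2 : e (τ + 1) = e τ := e_eq_e_of_sub_eq_int 1 (by simp)
  rw [h1, h1, h2, add_div, e_add]
  ring

/-- The exponent of the theta quotient at `i∞`. -/
def thetaExponent (d : ℕ) (i : Fin d) : ℂ := (i + 1 / 2) ^ 2 / (2 * (2 * d + 1 : ℕ)) - 1 / 24

lemma thetaQuot_slash_T (d : ℕ) (i : Fin d) :
    thetaQuot d i ∣[(0 : ℤ)] ModularGroup.T = fun τ ↦ e (thetaExponent d i) * thetaQuot d i τ := by
  ext τ
  rw [ModularForm.SL_slash_apply, neg_zero, zpow_zero, mul_one, thetaQuot, thetaQuot]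
  have h : ((ModularGroup.T • τ : ℍ) : ℂ) = τ + 1 := by
    rw [UpperHalfPlane.modular_T_smul]
    simp [add_comm]
  rw [h, thetaSum_add_one, eta_add_one, thetaExponent, sub_eq_add_neg, e_add, e_neg]
  have := e_ne_zero (1 / 24)
  have := ModularForm.eta_ne_zero τ.2
  change ModularForm.eta (τ : ℂ) ≠ 0 at this
  field_simp

/-- The `l` series produced by inversion fold back onto `d` of them, and the factor `Complex.sqrt τ`
cancels against that of `η`. -/
lemma exists_thetaQuot_slash_S (d : ℕ) : ∃ ρ : Matrix (Fin d) (Fin d) ℂ,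
    ∀ j, thetaQuot d j ∣[(0 : ℤ)] ModularGroup.S = fun τ ↦ ∑ i, ρ i j * thetaQuot d i τ := by
  have hfold : ∀ j : Fin (2 * d + 1), ∃ r : Fin d → ℂ, ∀ τ,
      thetaSum (2 * d + 1) 0 (j - ((2 * d + 1 : ℕ) : ℝ) / 2) τ =
        ∑ i, r i * thetaSum (2 * d + 1) 0 (i + 1 / 2) τ := by
    intro j
    rcases thetaSum_fold d j.2 with h | ⟨i, h⟩
    · exact ⟨0, fun τ ↦ by rw [h]; simp⟩
    · exact ⟨Pi.single i 1, fun τ ↦ by rw [h]; simp [Pi.single_apply]⟩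
  choose r hr using hfold
  refine ⟨Matrix.of fun i j ↦ (Complex.exp (Real.log (2 * d + 1 : ℕ) / 2))⁻¹ *
    ∑ s : Fin (2 * d + 1), e ((j + 1 / 2) * (s - ((2 * d + 1 : ℕ) : ℂ) / 2) / (2 * d + 1 : ℕ)) *
      r s i, fun j ↦ ?_⟩
  ext τ
  rw [ModularForm.SL_slash_apply, neg_zero, zpow_zero, mul_one, thetaQuot]
  have h : ((ModularGroup.S • τ : ℍ) : ℂ) = -1 / τ := by
    rw [UpperHalfPlane.modular_S_smul]
    simp [neg_div]
  have h1 : ModularForm.eta (-1 / τ) =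
      (Complex.sqrt Complex.I)⁻¹ * (Complex.sqrt τ * ModularForm.eta τ) :=
    ModularForm.eta_comp_eq_csqrt_I_inv τ.2
  rw [h, thetaSum_neg_inv d j τ.2, h1]
  have h2 := ModularForm.eta_ne_zero τ.2
  change ModularForm.eta (τ : ℂ) ≠ 0 at h2
  have h3 := sqrt_ne_zero' Complex.I_ne_zero
  have h4 := sqrt_ne_zero' τ.ne_zero
  have h5 := Complex.exp_ne_zero (Real.log (2 * d + 1 : ℕ) / 2)
  simp_rw [hr]
  simp only [Matrix.of_apply, thetaQuot]
  have h6 : ∀ X : ℂ, Complex.sqrt τ / (Complex.exp (Real.log (2 * d + 1 : ℕ) / 2) *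
      Complex.sqrt Complex.I) * X /
        ((Complex.sqrt Complex.I)⁻¹ * (Complex.sqrt τ * ModularForm.eta τ)) =
      (Complex.exp (Real.log (2 * d + 1 : ℕ) / 2))⁻¹ * X / ModularForm.eta τ := by
    intro X
    field_simp
  refine (h6 _).trans ?_
  simp_rw [Finset.mul_sum, Finset.sum_mul, Finset.sum_div]
  rw [Finset.sum_comm]
  refine Finset.sum_congr rfl fun i _ ↦ Finset.sum_congr rfl fun s _ ↦ ?_
  change _ = _ * (_ / ModularForm.eta (τ : ℂ))
  ring

lemma tendsto_thetaSum_atImInfty (d : ℕ) (i : Fin d) :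
    Tendsto (fun τ : ℍ ↦ e (-((i + 1 / 2) ^ 2 / (2 * (2 * d + 1 : ℕ)) : ℂ) * τ) *
      thetaSum (2 * d + 1) 0 (i + 1 / 2) τ) atImInfty (𝓝 1) := by
  set c : ℤ → ℝ := fun m ↦ ((2 * d + 1) * m ^ 2 + (2 * i + 1) * m) / 2 with hc
  have hcabs : ∀ m : ℤ, |(m : ℝ)| ≤ (m : ℝ) ^ 2 := by
    intro m
    rcases eq_or_ne m 0 with rfl | hm
    · simp
    · have : (1 : ℝ) ≤ |(m : ℝ)| := by exact_mod_cast Int.one_le_abs hm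
      rw [← sq_abs]
      nlinarith
  have hid : (i : ℝ) + 1 ≤ d := by exact_mod_cast i.2
  have hc1 : ∀ m : ℤ, (m : ℝ) ^ 2 ≤ c m := by
    intro m
    have h1 := hcabs m
    have h2 := neg_abs_le (m : ℝ)
    -- Here `i < d` enters: `2 i + 1 ≤ 2 d - 1` leaves at least `m ^ 2`, so `m = 0` is the only term
    -- surviving at `i∞`.
    simp only [hc]
    have h3 : -((2 * (i : ℝ) + 1) * |(m : ℝ)|) ≤ (2 * i + 1) * m := by nlinarith
    have h4 : (2 * (i : ℝ) + 1) * |(m : ℝ)| ≤ (2 * d - 1) * (m : ℝ) ^ 2 := by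
      apply mul_le_mul (by linarith) h1 (abs_nonneg _) (by linarith)
    linarith
  have hterm : ∀ τ : ℍ, e (-((i + 1 / 2) ^ 2 / (2 * (2 * d + 1 : ℕ)) : ℂ) * τ) *
      thetaSum (2 * d + 1) 0 (i + 1 / 2) τ = ∑' m : ℤ, (-1) ^ m * e ((c m : ℝ) * τ) := by
    intro τ
    rw [thetaSum, ← tsum_mul_left]
    refine tsum_congr fun m ↦ ?_
    rw [thetaTerm, mul_zero, pow_zero, mul_one, mul_left_comm, ← e_add]
    congr 2
    have hd : (2 * (d : ℂ) + 1) ≠ 0 := by exact_mod_cast (by omega : 2 * d + 1 ≠ 0)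
    simp only [hc]
    push_cast
    field_simp
    ring
  simp_rw [hterm]
  have hg : ∑' m : ℤ, (if m = 0 then (1 : ℂ) else 0) = 1 := tsum_ite_eq 0 (fun _ ↦ (1 : ℂ))
  suffices h : Tendsto (fun τ : ℍ ↦ ∑' m : ℤ, (-1) ^ m * e ((c m : ℝ) * τ)) atImInfty
      (𝓝 (∑' m : ℤ, (if m = 0 then (1 : ℂ) else 0))) by rwa [hg] at h
  refine tendsto_tsum_of_dominated_convergence
    (bound := fun m : ℤ ↦ Real.exp (-(2 * π) * m ^ 2 + 0 * |(m : ℝ)|))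
    (summable_exp_neg_sq_add 0 Real.two_pi_pos) (fun m ↦ ?_) ?_
  · rcases eq_or_ne m 0 with rfl | hm
    · simp [hc]
    · rw [if_neg hm]
      have hpos : 0 < c m := by
        have : (0 : ℝ) < (m : ℝ) ^ 2 := by positivity
        linarith [hc1 m]
      rw [tendsto_zero_iff_norm_tendsto_zero]
      simp_rw [norm_mul, norm_neg_one_zpow, one_mul, norm_e_ofReal_mul]
      refine Real.tendsto_exp_atBot.comp ?_
      have h1 : Tendsto (fun τ : ℍ ↦ τ.im) atImInfty atTop := tendsto_comap
      have h2 := h1.const_mul_atTop_of_neg (r := -2 * π * c m) (by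
        have := Real.pi_pos
        have : 0 < π * c m := by positivity
        linarith)
      exact h2
  · have : {τ : ℍ | 1 ≤ τ.im} ∈ atImInfty := (atImInfty_mem _).mpr ⟨1, fun _ h ↦ h⟩
    filter_upwards [this] with τ hτ m
    rw [norm_mul, norm_neg_one_zpow, one_mul, norm_e_ofReal_mul, Real.exp_le_exp]
    have h1 : (m : ℝ) ^ 2 ≤ c m * τ.im := by
      have := hc1 m
      have h2 : 0 ≤ (m : ℝ) ^ 2 := sq_nonneg _
      have h3 : (1 : ℝ) ≤ τ.im := hτ
      nlinarith
    have h4 : (τ : ℂ).im = τ.im := rfl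
    rw [h4]
    nlinarith [Real.pi_pos]

lemma isModularFrame_thetaQuot (d : ℕ) : IsModularFrame (thetaQuot d) (thetaExponent d) where
  mdiff := mdifferentiable_thetaQuot d
  slash_T := thetaQuot_slash_T d
  slash_S := exists_thetaQuot_slash_S d
  inj := by
    intro i j hij
    have hd : (2 * (2 * d + 1 : ℕ) : ℂ) ≠ 0 := by exact_mod_cast (by omega : 2 * (2 * d + 1) ≠ 0)
    simp only [thetaExponent, sub_left_inj] at hij
    rw [div_left_inj' hd] at hij
    have h1 : ((i : ℕ) : ℂ) ^ 2 + i = (j : ℕ) ^ 2 + j := by linear_combination hij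
    have h2 : (i : ℕ) ^ 2 + (i : ℕ) = (j : ℕ) ^ 2 + (j : ℕ) := by exact_mod_cast h1
    ext
    nlinarith
  -- The squares `(i + 1 / 2) ^ 2` sum to `d (4 d ^ 2 - 1) / 12`; division by `2 (2 d + 1)` gives `d
  -- (2 d - 1) / 24`, and the `d` factors `η⁻¹` remove `d / 24`, leaving `d (d - 1) / 12`.
  sum_exponent := by
    have hd : (2 * (d : ℂ) + 1) ≠ 0 := by exact_mod_cast (by omega : 2 * d + 1 ≠ 0)
    have h1 : ∀ n : ℕ, ∑ i ∈ Finset.range n, ((i : ℂ) + 1 / 2) ^ 2 =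
        (n : ℂ) * (4 * (n : ℂ) ^ 2 - 1) / 12 := by
      intro n
      induction n with
      | zero => simp
      | succ n ih =>
        rw [Finset.sum_range_succ, ih]
        push_cast
        ring
    simp only [thetaExponent]
    rw [Finset.sum_sub_distrib, ← Finset.sum_div,
      Fin.sum_univ_eq_sum_range (fun i ↦ ((i : ℂ) + 1 / 2) ^ 2), h1]
    simp only [Finset.sum_const, Finset.card_univ, Fintype.card_fin, nsmul_eq_mul]
    have h2 : ((d * (d - 1) : ℕ) : ℂ) = d * (d - 1) := by
      rcases d with _ | d
      · simp
      · simp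
    have h3 : (d : ℂ) * (4 * (d : ℂ) ^ 2 - 1) / 12 / (2 * (2 * d + 1)) = d * (2 * d - 1) / 24 := by
      rw [div_div, div_eq_div_iff (by simpa using hd) (by norm_num)]
      ring
    rw [h2]
    push_cast
    rw [h3]
    ring
  tendsto := by
    intro i
    have h := (tendsto_thetaSum_atImInfty d i).div tendsto_e_mul_eta one_ne_zero
    rw [div_one] at h
    refine h.congr fun τ ↦ ?_
    simp only [Pi.div_apply]
    rw [thetaQuot, thetaExponent, neg_sub', sub_mul, sub_eq_add_neg, e_add, ← neg_mul, neg_neg]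
    have h1 : e (-(1 / 24) * τ) = (e (1 / 24 * τ))⁻¹ := by rw [← e_neg, neg_mul]
    rw [h1]
    have := e_ne_zero (1 / 24 * τ)
    field_simp

/-! ### Heat operators as polynomials with coefficients in `τ` -/

lemma normalizedDeriv_mul {F G : ℍ → ℂ} (hF : MDiff F) (hG : MDiff G) (τ : ℍ) :
    normalizedDerivOfComplex (fun τ ↦ F τ * G τ) τ =
      normalizedDerivOfComplex F τ * G τ + F τ * normalizedDerivOfComplex G τ :=
  congrFun (normalizedDerivOfComplex_mul F G hF hG) τ

lemma normalizedDeriv_const_mul {F : ℍ → ℂ} (c : ℂ) (hF : MDiff F) (τ : ℍ) :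
    normalizedDerivOfComplex (fun τ ↦ c * F τ) τ = c * normalizedDerivOfComplex F τ :=
  congrFun (normalizedDerivOfComplex_smul c F hF) τ

lemma normalizedDeriv_sum {ι : Type*} (s : Finset ι) {F : ι → ℍ → ℂ} (hF : ∀ i ∈ s, MDiff (F i))
    (τ : ℍ) : normalizedDerivOfComplex (fun τ ↦ ∑ i ∈ s, F i τ) τ =
      ∑ i ∈ s, normalizedDerivOfComplex (F i) τ := by
  simp only [normalizedDerivOfComplex]
  rw [← Finset.mul_sum]
  congr 1
  exact deriv_fun_sum (A := fun i ↦ F i ∘ ofComplex)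
    fun i hi ↦ UpperHalfPlane.mdifferentiableAt_iff.mp (hF i hi τ)

/-- Coefficients of `H_{2k-1} ⋯ H_1` as a polynomial in the heat operator without its `E₂` term. -/
def heatCoeff (l : ℕ) : ℕ → ℕ → ℍ → ℂ
  | 0, 0 => fun _ ↦ 1
  | 0, _ + 1 => fun _ ↦ 0
  | k + 1, 0 => fun τ ↦ 2 * l * normalizedDerivOfComplex (heatCoeff l k 0) τ -
      l * (4 * k + 1) / 12 * EisensteinSeries.E2 τ * heatCoeff l k 0 τ
  | k + 1, i + 1 => fun τ ↦ 2 * l * normalizedDerivOfComplex (heatCoeff l k (i + 1)) τ +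
      heatCoeff l k i τ - l * (4 * k + 1) / 12 * EisensteinSeries.E2 τ * heatCoeff l k (i + 1) τ

lemma heatCoeff_eq_zero (l : ℕ) {k i : ℕ} (h : k < i) : heatCoeff l k i = fun _ ↦ 0 := by
  induction k generalizing i with
  | zero =>
    obtain ⟨i, rfl⟩ := Nat.exists_eq_add_of_lt h
    rw [zero_add, heatCoeff]
  | succ k ih =>
    obtain ⟨i, rfl⟩ : ∃ j, i = j + 1 := ⟨i - 1, by omega⟩
    ext τ
    rw [heatCoeff, ih (by omega : k < i), ih (by omega : k < i + 1),
      normalizedDerivOfComplex_const]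
    simp

lemma heatCoeff_self (l k : ℕ) (τ : ℍ) : heatCoeff l k k τ = 1 := by
  induction k with
  | zero => simp [heatCoeff]
  | succ k ih =>
    simp only [heatCoeff]
    rw [ih, heatCoeff_eq_zero l (Nat.lt_succ_self k), normalizedDerivOfComplex_const]
    simp

lemma mdifferentiable_heatCoeff (l k i : ℕ) : MDiff (heatCoeff l k i) := by
  induction k generalizing i with
  | zero => rcases i with _ | i <;> exact mdifferentiable_const
  | succ k ih =>
    have hE : ∀ i, MDiff (fun τ ↦ l * (4 * k + 1) / 12 * EisensteinSeries.E2 τ *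
        heatCoeff l k i τ) := fun i ↦ mdifferentiable_mul
      (mdifferentiable_const_mul _ E2_mdifferentiable) (ih i)
    have hD : ∀ i, MDiff (fun τ ↦ 2 * l * normalizedDerivOfComplex (heatCoeff l k i) τ) :=
      fun i ↦ mdifferentiable_const_mul _ (normalizedDerivOfComplex_mdifferentiable (ih i))
    rcases i with _ | i
    · exact (hD 0).sub (hE 0)
    · exact ((hD (i + 1)).add (ih i)).sub (hE (i + 1))

lemma sum_heatCoeff_succ (l k : ℕ) (P : ℕ → ℂ) (τ : ℍ) :
    ∑ i ∈ Finset.range (k + 2), heatCoeff l (k + 1) i τ * P i =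
      2 * l * ∑ i ∈ Finset.range (k + 1), normalizedDerivOfComplex (heatCoeff l k i) τ * P i +
      ∑ i ∈ Finset.range (k + 1), heatCoeff l k i τ * P (i + 1) -
      l * (4 * k + 1) / 12 * EisensteinSeries.E2 τ *
        ∑ i ∈ Finset.range (k + 1), heatCoeff l k i τ * P i := by
  have h1 : ∑ i ∈ Finset.range (k + 1), normalizedDerivOfComplex (heatCoeff l k i) τ * P i =
      ∑ i ∈ Finset.range (k + 2), normalizedDerivOfComplex (heatCoeff l k i) τ * P i := by
    rw [Finset.sum_range_succ _ (k + 1), heatCoeff_eq_zero l (Nat.lt_succ_self k),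
      normalizedDerivOfComplex_const]
    simp
  have h2 : ∑ i ∈ Finset.range (k + 1), heatCoeff l k i τ * P i =
      ∑ i ∈ Finset.range (k + 2), heatCoeff l k i τ * P i := by
    rw [Finset.sum_range_succ _ (k + 1), heatCoeff_eq_zero l (Nat.lt_succ_self k)]
    simp
  rw [h1, h2, Finset.sum_range_succ' _ (k + 1), Finset.sum_range_succ' _ (k + 1),
    Finset.sum_range_succ' _ (k + 1), mul_add, mul_add, Finset.mul_sum, Finset.mul_sum]
  have h3 : ∑ i ∈ Finset.range (k + 1), heatCoeff l (k + 1) (i + 1) τ * P (i + 1) =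
      ∑ i ∈ Finset.range (k + 1),
        (2 * l * (normalizedDerivOfComplex (heatCoeff l k (i + 1)) τ * P (i + 1)) +
        heatCoeff l k i τ * P (i + 1) - l * (4 * k + 1) / 12 * EisensteinSeries.E2 τ *
          (heatCoeff l k (i + 1) τ * P (i + 1))) :=
    Finset.sum_congr rfl fun i _ ↦ by
      rw [heatCoeff]
      ring
  rw [h3, Finset.sum_sub_distrib, Finset.sum_add_distrib, heatCoeff]
  ring

/-- The `E₂` terms agree: clearing `η` contributes `1 / 24` and the Serre derivative in weight `2 k`
contributes `2 k / 12`; times `2 l` this is the `l (4 k + 1) / 12` of `H_{2k+1}`. -/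
lemma serreIter_thetaQuot (d : ℕ) (j : Fin d) (k : ℕ) (τ : ℍ) :
    (2 * (2 * d + 1 : ℕ) : ℂ) ^ k * ModularForm.eta τ * serreIter k (thetaQuot d j) τ =
      ∑ i ∈ Finset.range (k + 1),
        heatCoeff (2 * d + 1) k i τ * thetaSum (2 * d + 1) i (j + 1 / 2) τ := by
  set l := 2 * d + 1 with hl
  have hl0 : 0 < l := by omega
  induction k generalizing τ with
  | zero =>
    have := ModularForm.eta_ne_zero τ.2
    change ModularForm.eta (τ : ℂ) ≠ 0 at this
    simp only [serreIter, thetaQuot, heatCoeff, pow_zero, zero_add, Finset.range_one,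
      Finset.sum_singleton, one_mul]
    field_simp
    rfl
  | succ k ih =>
    have hX := mdifferentiable_serreIter k (mdifferentiable_thetaQuot d j)
    have hD := congrArg (fun F ↦ normalizedDerivOfComplex F τ) (funext ih)
    rw [normalizedDeriv_mul (mdifferentiable_const_mul _ mdifferentiable_eta) hX,
      normalizedDeriv_const_mul _ mdifferentiable_eta, normalizedDeriv_eta,
      normalizedDeriv_sum _ fun i _ ↦ mdifferentiable_mul (mdifferentiable_heatCoeff l k i)
        (mdifferentiable_thetaSum hl0 _ _)] at hD
    have hsum : 2 * l * ∑ i ∈ Finset.range (k + 1), normalizedDerivOfComplex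
        (fun τ ↦ heatCoeff l k i τ * thetaSum l i (j + 1 / 2) τ) τ =
        2 * l * ∑ i ∈ Finset.range (k + 1), normalizedDerivOfComplex (heatCoeff l k i) τ *
          thetaSum l i (j + 1 / 2) τ +
        ∑ i ∈ Finset.range (k + 1), heatCoeff l k i τ * thetaSum l (i + 1) (j + 1 / 2) τ := by
      rw [Finset.mul_sum, Finset.mul_sum, ← Finset.sum_add_distrib]
      refine Finset.sum_congr rfl fun i _ ↦ ?_
      rw [normalizedDeriv_mul (mdifferentiable_heatCoeff l k i) (mdifferentiable_thetaSum hl0 _ _),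
        ← normalizedDeriv_thetaSum hl0]
      ring
    rw [sum_heatCoeff_succ, ← hsum, ← hD, ← ih τ, serreIter, serreDerivative_apply]
    push_cast
    ring

/-- The modular differential equation satisfied by the theta series, in terms of `heatCoeff`. -/
theorem exists_modularForm_sum_heatCoeff_thetaSum (d : ℕ) :
    ∃ f : (j : ℕ) → ModularForm 𝒮ℒ (j : ℤ), (∀ τ, f 0 τ = 1) ∧
      ∀ j < 2 * d + 1, ∀ τ : ℍ, ∑ k ∈ Finset.range (d + 1), f (2 * d - 2 * k) τ *
        ∑ i ∈ Finset.range (k + 1), heatCoeff (2 * d + 1) k i τ *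
          thetaSum (2 * d + 1) i (j - ((2 * d + 1 : ℕ) : ℝ) / 2) τ = 0 := by
  obtain ⟨F, hF0, hF⟩ := (isModularFrame_thetaQuot d).exists_modularForm_sum_eq_zero
  have hc : (2 * (2 * d + 1 : ℕ) : ℂ) ≠ 0 := by exact_mod_cast (by omega : 2 * (2 * d + 1) ≠ 0)
  -- In weight `n = 2 d - 2 k` the factor `(2 l) ^ (d - k)` complements the `(2 l) ^ k` of
  -- `serreIter_thetaQuot`; in weight `0` it is `1`, so the equation stays monic.
  refine ⟨fun n ↦ (2 * (2 * d + 1 : ℕ) : ℂ) ^ (n / 2) • F n, fun τ ↦ by simp [hF0], ?_⟩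
  intro j hj τ
  rcases thetaSum_fold d hj with h | ⟨i, h⟩
  · simp [h, -Nat.cast_add, -Nat.cast_mul]
  · simp_rw [h, ← serreIter_thetaQuot]
    have h1 := congrArg (fun x ↦ (2 * (2 * d + 1 : ℕ) : ℂ) ^ d * ModularForm.eta τ * x) (hF i τ)
    simp only [mul_zero, Finset.mul_sum] at h1
    rw [← h1]
    refine Finset.sum_congr rfl fun k hk ↦ ?_
    have hkd : k ≤ d := by
      have := Finset.mem_range.mp hk
      omega
    have h2 : (2 * d - 2 * k) / 2 = d - k := by omega
    have h3 : (2 * (2 * d + 1 : ℕ) : ℂ) ^ d =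
        (2 * (2 * d + 1 : ℕ) : ℂ) ^ (d - k) * (2 * (2 * d + 1 : ℕ) : ℂ) ^ k := by
      rw [← pow_add, Nat.sub_add_cancel hkd]
    have h4 : ((2 * (2 * d + 1 : ℕ) : ℂ) ^ ((2 * d - 2 * k) / 2) • F (2 * d - 2 * k)) τ =
        (2 * (2 * d + 1 : ℕ) : ℂ) ^ (d - k) * F (2 * d - 2 * k) τ := by
      rw [h2]
      rfl
    rw [h4, h3]
    ring

/-! ### Summands of the Appell function: heat equation and bounds -/

/-- The elementary function `e (l (n + 1 / 2) u) / (1 - e u)`. -/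
def phi (l : ℕ) (n : ℤ) (u : ℂ) : ℂ := e (l * (n + 1 / 2) * u) / (1 - e u)

lemma differentiable_e_const_mul (c : ℂ) : Differentiable ℂ fun u ↦ e (c * u) :=
  fun z ↦ (hasDerivAt_e_const_mul c z).differentiableAt

lemma differentiable_e : Differentiable ℂ e := by
  simpa using differentiable_e_const_mul 1

lemma continuous_e : Continuous e := differentiable_e.continuous

lemma analyticAt_phi (l : ℕ) (n : ℤ) {u : ℂ} (hu : e u ≠ 1) : AnalyticAt ℂ (phi l n) u :=
  ((differentiable_e_const_mul _).analyticAt u).div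
    (analyticAt_const.sub (differentiable_e.analyticAt u)) (sub_ne_zero.mpr hu.symm)

lemma hasDerivAt_iteratedDeriv_phi (l : ℕ) (n : ℤ) (j : ℕ) {u : ℂ} (hu : e u ≠ 1) :
    HasDerivAt (iteratedDeriv j (phi l n)) (iteratedDeriv (j + 1) (phi l n) u) u := by
  rw [iteratedDeriv_succ, iteratedDeriv_eq_iterate]
  exact ((analyticAt_phi l n hu).iterated_deriv j).differentiableAt.hasDerivAt

lemma half_le_norm_one_sub_e {w : ℂ} (hw : 1 / 2 ≤ |w.im|) : 1 / 2 ≤ ‖1 - e w‖ := by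
  have h4 : 4 ≤ Real.exp π := by linarith [Real.add_one_le_exp π, Real.pi_gt_three]
  rcases le_abs.mp hw with h | h
  · have h1 : ‖e w‖ ≤ 1 / 4 := by
      rw [norm_e]
      calc Real.exp (-2 * π * w.im) ≤ Real.exp (-π) := by
            rw [Real.exp_le_exp]
            nlinarith [Real.pi_pos]
        _ ≤ 1 / 4 := by
            rw [Real.exp_neg, one_div]
            exact inv_anti₀ (by norm_num) h4
    have h2 := norm_sub_norm_le 1 (e w)
    rw [norm_one] at h2
    linarith
  · have h1 : 4 ≤ ‖e w‖ := by
      rw [norm_e]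
      refine h4.trans (Real.exp_le_exp.mpr ?_)
      nlinarith [Real.pi_pos]
    have h2 := norm_sub_norm_le (e w) 1
    rw [norm_one, norm_sub_rev] at h2
    linarith

lemma e_ne_one_of_im {w : ℂ} (hw : 1 / 2 ≤ |w.im|) : e w ≠ 1 := by
  intro h
  have := half_le_norm_one_sub_e hw
  rw [h, sub_self, norm_zero] at this
  linarith

/-- Cauchy's estimate on a disc of radius `1 / 2`, which stays at distance `1 / 2` from the real
axis and hence from the poles. -/
lemma norm_iteratedDeriv_phi_le (l : ℕ) (n : ℤ) (j : ℕ) {u : ℂ} (hu : 1 ≤ |u.im|) :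
    ‖iteratedDeriv j (phi l n) u‖ ≤ j.factorial * (2 * Real.exp (-2 * π * (l * (n + 1 / 2)) * u.im +
      π * l * |(n : ℝ) + 1 / 2|)) / (1 / 2) ^ j := by
  have him : ∀ w ∈ Metric.closedBall u (1 / 2), |w.im - u.im| ≤ 1 / 2 := by
    intro w hw
    rw [← Complex.sub_im]
    exact (Complex.abs_im_le_norm _).trans (by simpa [dist_eq_norm] using hw)
  have him' : ∀ w ∈ Metric.closedBall u (1 / 2), 1 / 2 ≤ |w.im| := by
    intro w hw
    have h1 := him w hw
    have h2 := abs_sub_abs_le_abs_sub u.im w.im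
    rw [abs_sub_comm] at h2
    linarith
  refine Complex.norm_iteratedDeriv_le_of_forall_mem_sphere_norm_le j (by norm_num)
    (DifferentiableOn.diffContOnCl fun w hw ↦ ?_) fun w hw ↦ ?_
  · exact (analyticAt_phi l n (e_ne_one_of_im
      (him' w (Metric.closure_ball_subset_closedBall hw)))).differentiableAt.differentiableWithinAt
  · have hw' := Metric.sphere_subset_closedBall hw
    have h1 := half_le_norm_one_sub_e (him' w hw')
    have h2 : ‖e (l * (n + 1 / 2) * w)‖ ≤ Real.exp (-2 * π * (l * (n + 1 / 2)) * u.im +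
        π * l * |(n : ℝ) + 1 / 2|) := by
      have h3 : (l * (n + 1 / 2) * w : ℂ) = ((l * (n + 1 / 2) : ℝ) : ℂ) * w := by push_cast; rfl
      rw [h3, norm_e_ofReal_mul, Real.exp_le_exp]
      have h4 : -(((n : ℝ) + 1 / 2) * (w.im - u.im)) ≤ |(n : ℝ) + 1 / 2| * (1 / 2) := by
        refine (neg_le_abs _).trans ?_
        rw [abs_mul]
        exact mul_le_mul_of_nonneg_left (him w hw') (abs_nonneg _)
      have h5 := mul_le_mul_of_nonneg_left h4 (by positivity : 0 ≤ 2 * π * l)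
      linarith
    rw [phi, norm_div, div_le_iff₀ (by linarith)]
    have := (Real.exp_pos (-2 * π * (l * (n + 1 / 2)) * u.im + π * l * |(n : ℝ) + 1 / 2|)).le
    nlinarith

/-- An auxiliary building block of the derivatives of the summands of the Appell function. -/
def appellAux (l j : ℕ) (n : ℤ) (z τ : ℂ) : ℂ :=
  e (-(l * n ^ 2 / 2) * τ - l * n * z) * iteratedDeriv j (phi l n) (z + n * τ)

/-- The summand of `appellSum`. -/
def appellTerm (l k : ℕ) (n : ℤ) (z τ : ℂ) : ℂ :=
  (-1) ^ n * ((2 * π * Complex.I) ^ (2 * k))⁻¹ * appellAux l (2 * k) n z τ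

/-- The `k`-fold image of the Appell function under the heat operator without `E₂` term. -/
def appellSum (l k : ℕ) (z τ : ℂ) : ℂ := ∑' n : ℤ, appellTerm l k n z τ

lemma hasDerivAt_appellAux_left (l j : ℕ) (n : ℤ) {z τ : ℂ} (h : e (z + n * τ) ≠ 1) :
    HasDerivAt (fun x ↦ appellAux l j n x τ)
      (-(2 * π * Complex.I * (l * n)) * appellAux l j n z τ + appellAux l (j + 1) n z τ) z := by
  have h1 := (hasDerivAt_iteratedDeriv_phi l n j h).comp z ((hasDerivAt_id z).add_const (n * τ))
  have h2 : HasDerivAt (fun x ↦ e (-(l * n ^ 2 / 2) * τ - l * n * x))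
      (-(2 * π * Complex.I * (l * n)) * e (-(l * n ^ 2 / 2) * τ - l * n * z)) z := by
    have h3 := (hasDerivAt_e_const_mul (-(l * n)) z).const_mul (e (-(l * n ^ 2 / 2) * τ))
    have h4 : ∀ x, e (-(l * n ^ 2 / 2) * τ - l * n * x) =
        e (-(l * n ^ 2 / 2) * τ) * e (-(l * n) * x) := fun x ↦ by
      rw [← e_add]
      ring_nf
    rw [funext h4]
    exact h3.congr_deriv (by rw [h4]; ring)
  refine (h2.mul h1).congr_deriv ?_
  simp only [appellAux, Function.comp_apply, id]
  ring

lemma hasDerivAt_appellAux_right (l j : ℕ) (n : ℤ) {z τ : ℂ} (h : e (z + n * τ) ≠ 1) :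
    HasDerivAt (fun t ↦ appellAux l j n z t)
      (-(2 * π * Complex.I * (l * n ^ 2 / 2)) * appellAux l j n z τ +
        n * appellAux l (j + 1) n z τ) τ := by
  have h1 := (hasDerivAt_iteratedDeriv_phi l n j h).comp τ
    (((hasDerivAt_id τ).const_mul (n : ℂ)).const_add z)
  have h2 : HasDerivAt (fun t ↦ e (-(l * n ^ 2 / 2) * t - l * n * z))
      (-(2 * π * Complex.I * (l * n ^ 2 / 2)) * e (-(l * n ^ 2 / 2) * τ - l * n * z)) τ := by
    have h3 := (hasDerivAt_e_const_mul (-(l * n ^ 2 / 2)) τ).mul_const (e (-(l * n * z)))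
    have h4 : ∀ t, e (-(l * n ^ 2 / 2) * t - l * n * z) =
        e (-(l * n ^ 2 / 2) * t) * e (-(l * n * z)) := fun x ↦ by
      rw [← e_add]
      ring_nf
    rw [funext h4]
    exact h3.congr_deriv (by rw [h4]; ring)
  refine (h2.mul h1).congr_deriv ?_
  simp only [appellAux, Function.comp_apply, id]
  ring

lemma isOpen_setOf_e_ne_one (n : ℤ) (τ : ℂ) : IsOpen {x : ℂ | e (x + n * τ) ≠ 1} :=
  isOpen_ne_fun (continuous_e.comp (by fun_prop)) continuous_const

lemma iteratedDeriv_two_eq (g : ℂ → ℂ) : iteratedDeriv 2 g = deriv (deriv g) := by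
  rw [iteratedDeriv_succ, iteratedDeriv_one]

/-- On a term `e (-(l n ^ 2 / 2) τ - l n z) G (z + n τ)`, write `∂` for `(2πi)⁻¹` times the
derivative of `G`. Then `2 l (-l n ^ 2 / 2 + n ∂) + (-l n + ∂) ^ 2 = ∂ ^ 2`: everything but the
second derivative cancels. -/
lemma heat_appellTerm (l k : ℕ) (n : ℤ) {z τ : ℂ} (h : e (z + n * τ) ≠ 1) :
    2 * l * ((2 * π * Complex.I)⁻¹ * deriv (fun t ↦ appellTerm l k n z t) τ) +
      1 / (2 * π * Complex.I) ^ 2 * iteratedDeriv 2 (fun x ↦ appellTerm l k n x τ) z =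
      appellTerm l (k + 1) n z τ := by
  set C : ℂ := (-1) ^ n * ((2 * π * Complex.I) ^ (2 * k))⁻¹ with hC
  have hπ : (2 * π * Complex.I : ℂ) ≠ 0 := Complex.two_pi_I_ne_zero
  have h1 : deriv (fun t ↦ appellTerm l k n z t) τ =
      C * (-(2 * π * Complex.I * (l * n ^ 2 / 2)) * appellAux l (2 * k) n z τ +
        n * appellAux l (2 * k + 1) n z τ) :=
    ((hasDerivAt_appellAux_right l (2 * k) n h).const_mul C).deriv
  have h2 : deriv (fun x ↦ appellTerm l k n x τ) =ᶠ[𝓝 z] fun x ↦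
      C * (-(2 * π * Complex.I * (l * n)) * appellAux l (2 * k) n x τ +
        appellAux l (2 * k + 1) n x τ) := by
    filter_upwards [(isOpen_setOf_e_ne_one n τ).mem_nhds h] with x hx
    exact ((hasDerivAt_appellAux_left l (2 * k) n hx).const_mul C).deriv
  have h3 : iteratedDeriv 2 (fun x ↦ appellTerm l k n x τ) z =
      C * (-(2 * π * Complex.I * (l * n)) *
        (-(2 * π * Complex.I * (l * n)) * appellAux l (2 * k) n z τ +
          appellAux l (2 * k + 1) n z τ) +
        (-(2 * π * Complex.I * (l * n)) * appellAux l (2 * k + 1) n z τ +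
          appellAux l (2 * k + 1 + 1) n z τ)) := by
    rw [iteratedDeriv_two_eq, h2.deriv_eq]
    exact ((((hasDerivAt_appellAux_left l (2 * k) n h).const_mul _).add
      (hasDerivAt_appellAux_left l (2 * k + 1) n h)).const_mul C).deriv
  have h4 : appellTerm l (k + 1) n z τ =
      C * ((2 * π * Complex.I) ^ 2)⁻¹ * appellAux l (2 * k + 1 + 1) n z τ := by
    rw [appellTerm, hC, mul_add, pow_add, mul_inv]
    ring_nf
  rw [h1, h3, h4]
  generalize (2 * π * Complex.I : ℂ) = c at hπ
  field_simp
  ring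

lemma continuousAt_appellTerm (l k : ℕ) (n : ℤ) {z τ : ℂ} (h : e (z + n * τ) ≠ 1) :
    ContinuousAt (fun p : ℂ × ℂ ↦ appellTerm l k n p.1 p.2) (z, τ) := by
  have h1 : ContinuousAt (fun p : ℂ × ℂ ↦ iteratedDeriv (2 * k) (phi l n) (p.1 + n * p.2))
      (z, τ) :=
    ContinuousAt.comp (f := fun p : ℂ × ℂ ↦ p.1 + n * p.2) (x := (z, τ))
      (g := iteratedDeriv (2 * k) (phi l n)) (hasDerivAt_iteratedDeriv_phi l n (2 * k) h).continuousAt (by fun_prop)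
  have h2 : ContinuousAt (fun p : ℂ × ℂ ↦ e (-(l * n ^ 2 / 2) * p.2 - l * n * p.1)) (z, τ) :=
    (continuous_e.comp (by fun_prop)).continuousAt
  exact continuousAt_const.mul (h2.mul h1)

/-- The prefactor grows like `exp (π l n ^ 2 Im τ)`, but `phi` at `z + n τ` decays with twice that
exponent, so a Gaussian remains. -/
lemma norm_appellTerm_le (l k : ℕ) (n : ℤ) {z τ : ℂ} {y₀ y₁ Y : ℝ} (h0 : 0 < y₀)
    (h1 : y₀ ≤ τ.im) (h2 : τ.im ≤ y₁) (h3 : |z.im| ≤ Y) (h : 1 ≤ |(z + n * τ).im|) :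
    ‖appellTerm l k n z τ‖ ≤ ‖((2 * π * Complex.I : ℂ) ^ (2 * k))⁻¹‖ *
      (((2 * k).factorial * 2 / (1 / 2) ^ (2 * k)) * Real.exp (π * l * (Y + 1 / 2))) *
      Real.exp (-(π * l * y₀) * n ^ 2 + π * l * (y₁ + 1) * |(n : ℝ)|) := by
  rw [appellTerm, norm_mul, norm_mul, norm_neg_one_zpow, one_mul, appellAux, norm_mul,
    mul_assoc ‖((2 * π * Complex.I : ℂ) ^ (2 * k))⁻¹‖]
  refine mul_le_mul_of_nonneg_left ?_ (norm_nonneg ((2 * π * Complex.I : ℂ) ^ (2 * k))⁻¹)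
  have h4 := norm_iteratedDeriv_phi_le l n (2 * k) h
  have h5 : ‖e (-(l * n ^ 2 / 2) * τ - l * n * z)‖ =
      Real.exp (2 * π * (l * n ^ 2 / 2 * τ.im + l * n * z.im)) := by
    rw [norm_e]
    congr 1
    have : (-(l * n ^ 2 / 2) * τ - l * n * z : ℂ) =
        ((-(l * n ^ 2 / 2) : ℝ) : ℂ) * τ - ((l * n : ℝ) : ℂ) * z := by push_cast; rfl
    rw [this, Complex.sub_im, Complex.im_ofReal_mul, Complex.im_ofReal_mul]
    ring
  have h6 : (z + n * τ).im = z.im + n * τ.im := by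
    have : (z + n * τ : ℂ) = z + ((n : ℝ) : ℂ) * τ := by push_cast; rfl
    rw [this, Complex.add_im, Complex.im_ofReal_mul]
  rw [h6] at h4
  rw [h5]
  refine (mul_le_mul_of_nonneg_left h4 (Real.exp_pos _).le).trans ?_
  have h7 : 2 * π * (l * n ^ 2 / 2 * τ.im + l * n * z.im) +
      (-2 * π * (l * (n + 1 / 2)) * (z.im + n * τ.im) + π * l * |(n : ℝ) + 1 / 2|) ≤
      π * l * (Y + 1 / 2) + (-(π * l * y₀) * n ^ 2 + π * l * (y₁ + 1) * |(n : ℝ)|) := by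
    have h8 : |(n : ℝ) + 1 / 2| ≤ |(n : ℝ)| + 1 / 2 :=
      (abs_add_le _ _).trans (by rw [abs_of_pos (by norm_num : (0 : ℝ) < 1 / 2)])
    have h9 : -z.im ≤ Y := (neg_le_abs _).trans h3
    have h10 : y₀ * (n : ℝ) ^ 2 ≤ τ.im * (n : ℝ) ^ 2 :=
      mul_le_mul_of_nonneg_right h1 (sq_nonneg _)
    have h11 : -((n : ℝ) * τ.im) ≤ |(n : ℝ)| * y₁ := by
      refine (neg_le_abs _).trans ?_
      rw [abs_mul, abs_of_pos (h0.trans_le h1)]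
      exact mul_le_mul_of_nonneg_left h2 (abs_nonneg _)
    have h12 : -(τ.im * (n : ℝ) ^ 2) - n * τ.im - z.im + |(n : ℝ) + 1 / 2| ≤
        Y + 1 / 2 - y₀ * n ^ 2 + (y₁ + 1) * |(n : ℝ)| := by linarith
    have h13 := mul_le_mul_of_nonneg_left h12 (by positivity : 0 ≤ π * l)
    linarith
  have h14 := Real.exp_le_exp.mpr h7
  rw [Real.exp_add, Real.exp_add (π * l * (Y + 1 / 2))] at h14
  have h15 : 0 ≤ ((2 * k).factorial * 2 / (1 / 2) ^ (2 * k) : ℝ) := by positivity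
  have h16 := mul_le_mul_of_nonneg_left h14 h15
  refine le_trans (le_of_eq ?_) (h16.trans (le_of_eq ?_))
  · ring
  · ring

/-- Locally uniform summable bounds for the summands whose poles are avoided. -/
lemma exists_appellTerm_bound {l : ℕ} (hl : 0 < l) (k : ℕ) (S : Set ℤ) {z τ : ℂ} (hτ : 0 < τ.im)
    (hS : ∀ n ∈ S, e (z + n * τ) ≠ 1) : ∃ V ∈ 𝓝 (z, τ), ∃ u : ℤ → ℝ, Summable u ∧ ∀ p ∈ V,
      0 < p.2.im ∧ ∀ n ∈ S, e (p.1 + n * p.2) ≠ 1 ∧ ‖appellTerm l k n p.1 p.2‖ ≤ u n := by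
  classical
  set y₀ := τ.im / 2 with hy₀
  have hy₀pos : 0 < y₀ := half_pos hτ
  set y₁ := τ.im + 1 with hy₁
  set Y := |z.im| + 1 with hY
  set V₀ : Set (ℂ × ℂ) := {p | y₀ < p.2.im ∧ p.2.im < y₁ ∧ |p.1.im| < Y} with hV₀
  have hV₀n : V₀ ∈ 𝓝 (z, τ) := by
    refine IsOpen.mem_nhds ?_ ⟨by simp only; linarith, by simp only; linarith, by simp only; linarith⟩
    have hc2 : Continuous fun p : ℂ × ℂ ↦ p.2.im := Complex.continuous_im.comp continuous_snd
    have hc1 : Continuous fun p : ℂ × ℂ ↦ |p.1.im| := (Complex.continuous_im.comp continuous_fst).abs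
    exact (isOpen_lt continuous_const hc2).inter
      ((isOpen_lt hc2 continuous_const).inter (isOpen_lt hc1 continuous_const))
  -- For `|n| ≥ N` the point `z + n τ` has height at least `1` throughout the neighbourhood and the
  -- Gaussian bound applies; the finitely many other terms are bounded by continuity.
  obtain ⟨N, hN⟩ := exists_nat_gt ((Y + 1) / y₀)
  rw [div_lt_iff₀ hy₀pos] at hN
  have hlarge : ∀ n : ℤ, n ∉ Finset.Icc (-N : ℤ) N → ∀ p ∈ V₀, 1 ≤ |(p.1 + n * p.2).im| := by
    intro n hn p hp
    have h1 : (N : ℝ) ≤ |(n : ℝ)| := by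
      have : (N : ℤ) ≤ |n| := by
        rw [Finset.mem_Icc, ← abs_le, not_le] at hn
        exact hn.le
      exact_mod_cast this
    have h6 : (p.1 + n * p.2).im = p.1.im + n * p.2.im := by
      have : (p.1 + n * p.2 : ℂ) = p.1 + ((n : ℝ) : ℂ) * p.2 := by push_cast; rfl
      rw [this, Complex.add_im, Complex.im_ofReal_mul]
    rw [h6]
    have h2 := abs_sub_abs_le_abs_sub (n * p.2.im) (-p.1.im)
    rw [abs_neg, sub_neg_eq_add, abs_mul, abs_of_pos (hy₀pos.trans hp.1), add_comm] at h2
    have h3 : N * y₀ ≤ |(n : ℝ)| * p.2.im := by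
      exact mul_le_mul h1 hp.1.le hy₀pos.le (abs_nonneg _)
    have := hp.2.2
    linarith
  have hsmall : ∀ n : ℤ, ∃ W ∈ 𝓝 (z, τ), n ∈ S → ∀ p ∈ W, e (p.1 + n * p.2) ≠ 1 ∧
      ‖appellTerm l k n p.1 p.2‖ ≤ ‖appellTerm l k n z τ‖ + 1 := by
    intro n
    by_cases hn : n ∈ S
    · have hc := (continuousAt_appellTerm l k n (hS n hn)).norm.eventually_lt_const
        (lt_add_one ‖appellTerm l k n z τ‖)
      have ho : IsOpen {p : ℂ × ℂ | e (p.1 + n * p.2) ≠ 1} :=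
        isOpen_ne_fun (continuous_e.comp (by fun_prop)) continuous_const
      exact ⟨_, inter_mem (ho.mem_nhds (hS n hn)) hc, fun _ p hp ↦ ⟨hp.1, le_of_lt hp.2⟩⟩
    · exact ⟨Set.univ, univ_mem, fun h ↦ absurd h hn⟩
  choose W hW hWS using hsmall
  set B : ℤ → ℝ := fun n ↦ ‖((2 * π * Complex.I : ℂ) ^ (2 * k))⁻¹‖ *
      (((2 * k).factorial * 2 / (1 / 2) ^ (2 * k)) * Real.exp (π * l * (Y + 1 / 2))) *
      Real.exp (-(π * l * y₀) * n ^ 2 + π * l * (y₁ + 1) * |(n : ℝ)|) with hB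
  have hl' : (0 : ℝ) < l := by exact_mod_cast hl
  have hBs : Summable B :=
    (summable_exp_neg_sq_add _ (by have := Real.pi_pos; positivity)).mul_left _
  refine ⟨V₀ ∩ ⋂ n ∈ Finset.Icc (-N : ℤ) N, W n,
    inter_mem hV₀n ((biInter_finset_mem _).mpr fun n _ ↦ hW n),
    fun n ↦ if n ∈ Finset.Icc (-N : ℤ) N then ‖appellTerm l k n z τ‖ + 1 else B n, ?_, ?_⟩
  · refine (summable_congr_cofinite ?_).mpr hBs
    filter_upwards [(Finset.Icc (-N : ℤ) N).finite_toSet.compl_mem_cofinite] with n hn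
    exact if_neg hn
  · rintro p ⟨hp0, hp⟩
    refine ⟨hy₀pos.trans hp0.1, fun n hn ↦ ?_⟩
    by_cases hnN : n ∈ Finset.Icc (-N : ℤ) N
    · simp only [hnN, if_true]
      exact hWS n hn p (Set.mem_iInter₂.mp hp n hnN)
    · simp only [hnN, if_false]
      have h1 := hlarge n hnN p hp0
      exact ⟨e_ne_one_of_im (by linarith),
        norm_appellTerm_le l k n hy₀pos hp0.1.le hp0.2.1.le hp0.2.2.le h1⟩

/-! ### Appell sums off the lattice and the heat operators -/

/-- `τ` lies in the upper half plane and `z` is not in the lattice `ℤ τ + ℤ`. -/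
def OffLattice (z τ : ℂ) : Prop := 0 < τ.im ∧ ∀ n : ℤ, e (z + n * τ) ≠ 1

lemma e_eq_one_iff {x : ℂ} : e x = 1 ↔ ∃ n : ℤ, x = n := by
  rw [e, Complex.exp_eq_one_iff]
  refine exists_congr fun n ↦ ?_
  rw [mul_comm (n : ℂ)]
  exact mul_right_inj' Complex.two_pi_I_ne_zero

lemma offLattice_iff {z : ℂ} {τ : ℍ} :
    OffLattice z τ ↔ ∀ m n : ℤ, z ≠ (m : ℂ) * (τ : ℂ) + (n : ℂ) := by
  refine ⟨fun h m n hz ↦ h.2 (-m) ?_, fun h ↦ ⟨τ.2, fun n hn ↦ ?_⟩⟩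
  · rw [e_eq_one_iff]
    exact ⟨n, by rw [hz]; push_cast; ring⟩
  · obtain ⟨m, hm⟩ := e_eq_one_iff.mp hn
    exact h (-n) m (by push_cast; linear_combination hm)

lemma OffLattice.eventually {z τ : ℂ} (h : OffLattice z τ) :
    ∀ᶠ p : ℂ × ℂ in 𝓝 (z, τ), OffLattice p.1 p.2 := by
  -- Only the avoidance of the poles is used here; level `1` and `k = 0` are arbitrary.
  obtain ⟨V, hV, u, -, hu⟩ := exists_appellTerm_bound one_pos 0 Set.univ h.1 fun n _ ↦ h.2 n
  filter_upwards [hV] with p hp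
  exact ⟨(hu p hp).1, fun n ↦ ((hu p hp).2 n trivial).1⟩

lemma tendsto_prodMk_left (z τ : ℂ) : Tendsto (fun x ↦ (x, τ)) (𝓝 z) (𝓝 (z, τ)) :=
  (Continuous.prodMk_left τ).tendsto z

lemma tendsto_prodMk_right (z τ : ℂ) : Tendsto (fun t ↦ (z, t)) (𝓝 τ) (𝓝 (z, τ)) :=
  (Continuous.prodMk_right z).tendsto τ

lemma hasSum_appellTerm {l : ℕ} (hl : 0 < l) (k : ℕ) {z τ : ℂ} (h : OffLattice z τ) :
    HasSum (fun n ↦ appellTerm l k n z τ) (appellSum l k z τ) := by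
  obtain ⟨V, hV, u, hu, hb⟩ := exists_appellTerm_bound hl k Set.univ h.1 fun n _ ↦ h.2 n
  exact (hu.of_norm_bounded fun n ↦ ((hb _ (mem_of_mem_nhds hV)).2 n trivial).2).hasSum

lemma differentiableAt_appellTerm_left (l k : ℕ) (n : ℤ) {z τ : ℂ} (h : e (z + n * τ) ≠ 1) :
    DifferentiableAt ℂ (fun x ↦ appellTerm l k n x τ) z :=
  ((hasDerivAt_appellAux_left l (2 * k) n h).const_mul _).differentiableAt

lemma differentiableAt_appellTerm_right (l k : ℕ) (n : ℤ) {z τ : ℂ} (h : e (z + n * τ) ≠ 1) :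
    DifferentiableAt ℂ (fun t ↦ appellTerm l k n z t) τ :=
  ((hasDerivAt_appellAux_right l (2 * k) n h).const_mul _).differentiableAt

lemma hasDerivAt_appellSum_right {l : ℕ} (hl : 0 < l) (k : ℕ) {z τ : ℂ} (h : OffLattice z τ) :
    HasDerivAt (fun t ↦ appellSum l k z t)
      (∑' n : ℤ, deriv (fun t ↦ appellTerm l k n z t) τ) τ := by
  obtain ⟨V, hV, u, hu, hb⟩ := exists_appellTerm_bound hl k Set.univ h.1 fun n _ ↦ h.2 n
  exact hasDerivAt_tsum_of_norm_le (f := fun n t ↦ appellTerm l k n z t) hu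
    (tendsto_prodMk_right z τ hV)
    (fun n t ht ↦ differentiableAt_appellTerm_right l k n ((hb _ ht).2 n trivial).1)
    (fun n t ht ↦ ((hb _ ht).2 n trivial).2)

lemma differentiableAt_appellSum_left {l : ℕ} (hl : 0 < l) (k : ℕ) {z τ : ℂ}
    (h : OffLattice z τ) : DifferentiableAt ℂ (fun x ↦ appellSum l k x τ) z := by
  obtain ⟨V, hV, u, hu, hb⟩ := exists_appellTerm_bound hl k Set.univ h.1 fun n _ ↦ h.2 n
  exact (hasDerivAt_tsum_of_norm_le (f := fun n x ↦ appellTerm l k n x τ) hu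
    (tendsto_prodMk_left z τ hV)
    (fun n t ht ↦ differentiableAt_appellTerm_left l k n ((hb _ ht).2 n trivial).1)
    (fun n t ht ↦ ((hb _ ht).2 n trivial).2)).differentiableAt

lemma contDiffAt_appellSum_left {l : ℕ} (hl : 0 < l) (k : ℕ) {z τ : ℂ}
    (h : OffLattice z τ) (n : WithTop ℕ∞) : ContDiffAt ℂ n (fun x ↦ appellSum l k x τ) z := by
  refine (Complex.analyticAt_iff_eventually_differentiableAt.mpr ?_).contDiffAt
  filter_upwards [tendsto_prodMk_left z τ h.eventually] with x hx
  exact differentiableAt_appellSum_left hl k hx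

lemma heat_appellSum {l : ℕ} (hl : 0 < l) (k : ℕ) {z τ : ℂ} (h : OffLattice z τ) :
    2 * l * ((2 * π * Complex.I)⁻¹ * deriv (fun t ↦ appellSum l k z t) τ) +
      1 / (2 * π * Complex.I) ^ 2 * iteratedDeriv 2 (fun x ↦ appellSum l k x τ) z =
      appellSum l (k + 1) z τ := by
  obtain ⟨V, hV, u, hu, hb⟩ := exists_appellTerm_bound hl k Set.univ h.1 fun n _ ↦ h.2 n
  have h2 := (hasSum_iteratedDeriv_two_of_norm_le (f := fun n x ↦ appellTerm l k n x τ) hu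
    (tendsto_prodMk_left z τ hV)
    (fun n t ht ↦ differentiableAt_appellTerm_left l k n ((hb _ ht).2 n trivial).1)
    (fun n t ht ↦ ((hb _ ht).2 n trivial).2)).mul_left (1 / (2 * π * Complex.I) ^ 2)
  have h3 := (hasSum_appellTerm hl (k + 1) h).sub h2
  have h1 : (fun n : ℤ ↦ appellTerm l (k + 1) n z τ -
      1 / (2 * π * Complex.I) ^ 2 * iteratedDeriv 2 (fun x ↦ appellTerm l k n x τ) z) =
      fun n : ℤ ↦ (2 * l * (2 * π * Complex.I)⁻¹) * deriv (fun t ↦ appellTerm l k n z t) τ := by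
    ext n
    rw [← heat_appellTerm l k n (h.2 n)]
    ring
  rw [h1] at h3
  have h4 := h3.tsum_eq
  rw [tsum_mul_left] at h4
  rw [(hasDerivAt_appellSum_right hl k h).deriv, ← mul_assoc, h4]
  change _ - 1 / (2 * π * Complex.I) ^ 2 * iteratedDeriv 2 (fun x ↦ appellSum l k x τ) z + _ = _
  ring

lemma neg_one_zpow_mul_odd {l : ℕ} (hl : Odd l) (n : ℤ) : (-1 : ℂ) ^ ((l : ℤ) * n) = (-1) ^ n := by
  rw [zpow_mul, zpow_natCast, hl.neg_one_pow]

lemma appell_eq_appellSum {l : ℕ} (hl : Odd l) (z : ℂ) (τ : ℍ) :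
    appell l z τ = appellSum l 0 z τ := by
  rw [appell, appellSum, ← tsum_mul_left]
  refine tsum_congr fun n ↦ ?_
  have h1 : e (τ : ℂ) ^ n = e (n * τ) := by
    rw [e, e, ← Complex.exp_int_mul]
    congr 1
    ring
  rw [neg_one_zpow_mul_odd hl, appellTerm, appellAux, mul_zero, pow_zero, iteratedDeriv_zero, phi,
    h1, ← e_add]
  have h2 : e ((l : ℂ) / 2 * z) * ((-1) ^ n * e ((l : ℂ) / 2 * n * (n + 1) * τ) /
      (1 - e (z + n * τ))) = (-1) ^ n * (e ((l : ℂ) / 2 * z) *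
      e ((l : ℂ) / 2 * n * (n + 1) * τ)) / (1 - e (z + n * τ)) := by ring
  rw [h2, ← e_add, inv_one, mul_one, ← mul_div_assoc, ← e_add, ← mul_div_assoc]
  congr 3
  ring

/-- Since the coefficients depend on `τ` only, the Leibniz rule for the heat operator reproduces the
recursion of `heatCoeff`. The formula is known off the lattice only, but that set is open, so it may
be differentiated. -/
lemma heatPow_appell {l : ℕ} (hl : Odd l) (k : ℕ) {z : ℂ} {τ : ℍ} (h : OffLattice z τ) :
    heatPow l k (appell l) z τ =
      ∑ i ∈ Finset.range (k + 1), heatCoeff l k i τ * appellSum l i z τ := by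
  have hl0 : 0 < l := hl.pos
  induction k generalizing z τ with
  | zero => simp [heatPow, heatCoeff, appell_eq_appellSum hl]
  | succ k ih =>
    rw [heatPow, heatOp, sum_heatCoeff_succ, ih h]
    have h1 : iteratedDeriv 2 (fun x ↦ heatPow l k (appell l) x τ) z =
        ∑ i ∈ Finset.range (k + 1), heatCoeff l k i τ *
          iteratedDeriv 2 (fun x ↦ appellSum l i x τ) z := by
      have h2 : (fun x ↦ heatPow l k (appell l) x τ) =ᶠ[𝓝 z]
          fun x ↦ ∑ i ∈ Finset.range (k + 1), heatCoeff l k i τ * appellSum l i x τ := by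
        filter_upwards [tendsto_prodMk_left z τ h.eventually] with x hx
        exact ih hx
      rw [h2.iteratedDeriv_eq, iteratedDeriv_fun_sum fun i _ ↦
        contDiffAt_const.mul (contDiffAt_appellSum_left hl0 i h _)]
      exact Finset.sum_congr rfl fun i _ ↦ iteratedDeriv_const_mul_field _ _
    have h3 : deriv (fun t : ℂ ↦ heatPow l k (appell l) z (ofComplex t)) τ =
        ∑ i ∈ Finset.range (k + 1),
          (2 * π * Complex.I * normalizedDerivOfComplex (heatCoeff l k i) τ * appellSum l i z τ +
          heatCoeff l k i τ * deriv (fun t ↦ appellSum l i z t) τ) := by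
      have h4 : (fun t : ℂ ↦ heatPow l k (appell l) z (ofComplex t)) =ᶠ[𝓝 (τ : ℂ)] fun t ↦
          ∑ i ∈ Finset.range (k + 1), (heatCoeff l k i ∘ ofComplex) t * appellSum l i z t := by
        filter_upwards [tendsto_prodMk_right z τ h.eventually] with t ht
        have h5 : ((ofComplex t : ℍ) : ℂ) = t := by
          rw [ofComplex_apply_of_im_pos ht.1]
        have := ih (z := z) (τ := ofComplex t) (by rwa [h5])
        rw [h5] at this
        exact this
      rw [h4.deriv_eq, deriv_fun_sum]
      · refine Finset.sum_congr rfl fun i _ ↦ ?_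
        rw [deriv_fun_mul
          (UpperHalfPlane.mdifferentiableAt_iff.mp (mdifferentiable_heatCoeff l k i τ))
          (hasDerivAt_appellSum_right hl0 i h).differentiableAt]
        simp only [normalizedDerivOfComplex, Function.comp_apply, ofComplex_apply]
        rw [mul_inv_cancel_left₀ Complex.two_pi_I_ne_zero]
      · exact fun i _ ↦ (UpperHalfPlane.mdifferentiableAt_iff.mp
          (mdifferentiable_heatCoeff l k i τ)).mul
          (hasDerivAt_appellSum_right hl0 i h).differentiableAt
    have h6 : ∑ i ∈ Finset.range (k + 1), heatCoeff l k i τ * appellSum l (i + 1) z τ =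
        2 * l * (2 * π * Complex.I)⁻¹ * ∑ i ∈ Finset.range (k + 1), heatCoeff l k i τ *
          deriv (fun t ↦ appellSum l i z t) τ +
        1 / (2 * π * Complex.I) ^ 2 * ∑ i ∈ Finset.range (k + 1), heatCoeff l k i τ *
          iteratedDeriv 2 (fun x ↦ appellSum l i x τ) z := by
      rw [Finset.mul_sum, Finset.mul_sum, ← Finset.sum_add_distrib]
      refine Finset.sum_congr rfl fun i _ ↦ ?_
      rw [← heat_appellSum hl0 i h]
      ring
    have h7 : ∑ i ∈ Finset.range (k + 1), 2 * π * Complex.I *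
        normalizedDerivOfComplex (heatCoeff l k i) τ * appellSum l i z τ =
        2 * π * Complex.I * ∑ i ∈ Finset.range (k + 1),
          normalizedDerivOfComplex (heatCoeff l k i) τ * appellSum l i z τ := by
      rw [Finset.mul_sum]
      exact Finset.sum_congr rfl fun i _ ↦ by ring
    rw [h1, h3, h6, Finset.sum_add_distrib, h7]
    have hπ : (π : ℂ) ≠ 0 := by exact_mod_cast Real.pi_ne_zero
    have hI := Complex.I_ne_zero
    push_cast
    field_simp
    ring

/-! ### Elliptic transformations of the Appell sums -/

lemma phi_add_one {l : ℕ} (hl : Odd l) (n : ℤ) (u : ℂ) : phi l n (u + 1) = -phi l n u := by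
  obtain ⟨d, rfl⟩ := hl
  have h1 : e (u + 1) = e u := e_eq_e_of_sub_eq_int 1 (by simp)
  have h2 : e (((2 * d + 1 : ℕ) : ℂ) * (n + 1 / 2) * (u + 1)) =
      -e (((2 * d + 1 : ℕ) : ℂ) * (n + 1 / 2) * u) := by
    have h3 : e (1 / 2) = -1 := by
      have := neg_one_zpow_eq_e 1
      simpa using this.symm
    have h4 : ((2 * d + 1 : ℕ) : ℂ) * (n + 1 / 2) * (u + 1) =
        (((2 * d + 1 : ℕ) : ℂ) * (n + 1 / 2) * u + 1 / 2) + (((2 * d + 1) * n + d : ℤ) : ℂ) := by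
      push_cast
      ring
    rw [e_eq_e_of_sub_eq_int _ h4, e_add, h3]
    ring
  rw [phi, phi, h1, h2, neg_div]

lemma appellSum_add_one {l : ℕ} (hl : Odd l) (k : ℕ) (z τ : ℂ) :
    appellSum l k (z + 1) τ = -appellSum l k z τ := by
  rw [appellSum, appellSum, ← tsum_neg]
  refine tsum_congr fun n ↦ ?_
  have h1 : e (-(l * n ^ 2 / 2) * τ - l * n * (z + 1)) = e (-(l * n ^ 2 / 2) * τ - l * n * z) :=
    e_eq_e_of_sub_eq_int (-(l * n)) (by push_cast; ring)
  have h2 : iteratedDeriv (2 * k) (phi l n) (z + 1 + n * τ) =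
      -iteratedDeriv (2 * k) (phi l n) (z + n * τ) := by
    have h3 := congrFun (iteratedDeriv_comp_add_const (2 * k) (phi l n) 1) (z + n * τ)
    simp only [phi_add_one hl] at h3
    rw [show z + 1 + n * τ = z + n * τ + 1 by ring, ← h3]
    exact iteratedDeriv_fun_neg _ _ _
  rw [appellTerm, appellTerm, appellAux, appellAux, h1, h2]
  ring

lemma iteratedDeriv_e_const_mul (k : ℕ) (c u : ℂ) :
    iteratedDeriv k (fun u ↦ e (c * u)) u = (2 * π * Complex.I * c) ^ k * e (c * u) := by
  induction k generalizing u with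
  | zero => simp
  | succ k ih =>
    rw [iteratedDeriv_succ, funext ih,
      ((hasDerivAt_e_const_mul c u).const_mul ((2 * π * Complex.I * c) ^ k)).deriv]
    ring

/-- Raising `n` by one multiplies `phi` by `e (l u)`, and `(1 - e (l u)) / (1 - e u)` is a finite
geometric sum. These exponentials are the source of the theta series. -/
lemma phi_eq_phi_sub_one_sub (l : ℕ) (n : ℤ) {u : ℂ} (hu : e u ≠ 1) :
    phi l n u = phi l (n - 1) u - ∑ j ∈ Finset.range l, e ((l * (n - 1 / 2) + j) * u) := by
  have h1 : ∀ j ∈ Finset.range l, e ((l * (n - 1 / 2) + j) * u) =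
      e (l * (n - 1 / 2) * u) * e u ^ j := by
    intro j _
    rw [e_pow, ← e_add]
    ring_nf
  have h2 : e (l * (n + 1 / 2) * u) = e (l * (n - 1 / 2) * u) * e u ^ l := by
    rw [e_pow, ← e_add]
    ring_nf
  rw [Finset.sum_congr rfl h1, ← Finset.mul_sum, geom_sum_eq hu, phi, phi, h2]
  have h3 : (((n - 1 : ℤ) : ℂ) + 1 / 2) = n - 1 / 2 := by
    push_cast
    ring
  have h4 : (1 - e u) ≠ 0 := sub_ne_zero.mpr hu.symm
  have h5 : (e u - 1) ≠ 0 := sub_ne_zero.mpr hu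
  have h6 : (e u ^ l - 1) / (e u - 1) = (1 - e u ^ l) / (1 - e u) := by
    rw [div_eq_div_iff h5 h4]
    ring
  rw [h3, h6]
  field_simp
  ring

lemma iteratedDeriv_phi_eq (l : ℕ) (n : ℤ) (k : ℕ) {u : ℂ} (hu : e u ≠ 1) :
    iteratedDeriv k (phi l n) u = iteratedDeriv k (phi l (n - 1)) u -
      ∑ j ∈ Finset.range l, (2 * π * Complex.I * (l * (n - 1 / 2) + j)) ^ k *
        e ((l * (n - 1 / 2) + j) * u) := by
  have h1 : phi l n =ᶠ[𝓝 u] fun u ↦ phi l (n - 1) u -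
      ∑ j ∈ Finset.range l, e ((l * (n - 1 / 2) + j) * u) := by
    filter_upwards [(isOpen_ne_fun continuous_e continuous_const).mem_nhds hu] with v hv
    exact phi_eq_phi_sub_one_sub l n hv
  have hcd : ∀ j ∈ Finset.range l,
      ContDiffAt ℂ k (fun u ↦ e ((l * (n - 1 / 2) + j) * u)) u :=
    fun j _ ↦ ((differentiable_e_const_mul _).analyticAt u).contDiffAt
  rw [h1.iteratedDeriv_eq, iteratedDeriv_fun_sub (analyticAt_phi l (n - 1) hu).contDiffAt
    (ContDiffAt.sum hcd), iteratedDeriv_fun_sum hcd]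
  simp_rw [iteratedDeriv_e_const_mul]

/-- The elliptic transformation of the Appell sums with respect to `z ↦ z + τ`. -/
lemma appellSum_add_tau {l : ℕ} (hl : Odd l) (k : ℕ) {z τ : ℂ} (h : OffLattice z τ) :
    e (-l * z - l / 2 * τ) * appellSum l k (z + τ) τ + appellSum l k z τ =
      -∑ j ∈ Finset.range l, e ((j - l / 2) * z - (j - l / 2) ^ 2 / (2 * l) * τ) *
        thetaSum l k (j - (l : ℝ) / 2) τ := by
  have hl0 : 0 < l := hl.pos
  have hlC : (l : ℂ) ≠ 0 := by exact_mod_cast hl0.ne'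
  have h' : OffLattice (z + τ) τ := ⟨h.1, fun n ↦ by
    have := h.2 (n + 1)
    push_cast at this
    rwa [show z + τ + n * τ = z + (n + 1) * τ by ring]⟩
  have h1 : HasSum (fun n ↦ appellTerm l k (n - 1) (z + τ) τ) (appellSum l k (z + τ) τ) :=
    ((Equiv.subRight (1 : ℤ)).hasSum_iff).mpr (hasSum_appellTerm hl0 k h')
  have h2 := (h1.mul_left (e (-l * z - l / 2 * τ))).add (hasSum_appellTerm hl0 k h)
  have h3 : HasSum (fun m ↦ -∑ j ∈ Finset.range l,
      e ((j - l / 2) * z - (j - l / 2) ^ 2 / (2 * l) * τ) *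
        thetaTerm l k (j - (l : ℝ) / 2) m τ) (-∑ j ∈ Finset.range l,
      e ((j - l / 2) * z - (j - l / 2) ^ 2 / (2 * l) * τ) *
        thetaSum l k (j - (l : ℝ) / 2) τ) :=
    (hasSum_sum fun j _ ↦ (hasSum_thetaTerm hl0 k _ h.1).mul_left _).neg
  refine h2.unique ?_
  refine (congrArg (fun f ↦ HasSum f _) (funext fun m ↦ ?_)).mpr h3
  simp only [appellTerm, appellAux]
  -- With the index of the shifted sum lowered by one, both summands have their pole at `z + m τ =
  -- 0` modulo `ℤ` and opposite signs; the `phi` parts cancel and only the exponentials are left.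
  rw [iteratedDeriv_phi_eq l m (2 * k) (h.2 m)]
  have hz : z + τ + ((m - 1 : ℤ) : ℂ) * τ = z + m * τ := by
    push_cast
    ring
  have hs : (-1 : ℂ) ^ (m - 1) = -(-1) ^ m := by
    rw [zpow_sub_one₀ (by norm_num)]
    norm_num
  have he : e (-l * z - l / 2 * τ) *
      e (-(l * ((m - 1 : ℤ) : ℂ) ^ 2 / 2) * τ - l * ((m - 1 : ℤ) : ℂ) * (z + τ)) =
      e (-(l * m ^ 2 / 2) * τ - l * m * z) := by
    rw [← e_add]
    congr 1
    push_cast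
    ring
  rw [hz, hs, mul_sub, mul_sub, Finset.mul_sum, Finset.mul_sum]
  -- Completing the square, with `l (m - 1 / 2) + j = l m + (j - l / 2)`, identifies each
  -- exponential with a theta summand.
  have hterm : ∀ j ∈ Finset.range l,
      e ((j - l / 2) * z - (j - l / 2) ^ 2 / (2 * l) * τ) *
        thetaTerm l k (j - (l : ℝ) / 2) m τ =
      (-1) ^ m * ((2 * π * Complex.I) ^ (2 * k))⁻¹ * (e (-(l * m ^ 2 / 2) * τ - l * m * z) *
        ((2 * π * Complex.I * (l * (m - 1 / 2) + j)) ^ (2 * k) *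
          e ((l * (m - 1 / 2) + j) * (z + m * τ)))) := by
    intro j _
    have hc : (l * m + ((j - (l : ℝ) / 2 : ℝ) : ℂ)) = l * (m - 1 / 2) + j := by
      push_cast
      ring
    have hE : e ((j - l / 2) * z - (j - l / 2) ^ 2 / (2 * l) * τ) *
        e ((l * (m - 1 / 2) + j) ^ 2 / (2 * l) * τ) =
        e (-(l * m ^ 2 / 2) * τ - l * m * z) * e ((l * (m - 1 / 2) + j) * (z + m * τ)) := by
      rw [← e_add, ← e_add]
      congr 1
      field_simp
      ring
    rw [thetaTerm, hc, mul_pow (2 * π * Complex.I)]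
    have hp : ((2 * π * Complex.I : ℂ) ^ (2 * k)) ≠ 0 := pow_ne_zero _ Complex.two_pi_I_ne_zero
    generalize (2 * π * Complex.I : ℂ) ^ (2 * k) = c at hp
    generalize e ((j - l / 2) * z - (j - l / 2) ^ 2 / (2 * l) * τ) = E₁ at hE ⊢
    generalize e ((l * (m - 1 / 2) + j) ^ 2 / (2 * l) * τ) = E₂ at hE ⊢
    generalize e (-(l * m ^ 2 / 2) * τ - l * m * z) = E₃ at hE ⊢
    generalize e ((l * (m - 1 / 2) + j) * (z + m * τ)) = E₄ at hE ⊢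
    generalize (l * (m - 1 / 2) + j : ℂ) ^ (2 * k) = x
    field_simp
    linear_combination x * hE
  rw [Finset.sum_congr rfl hterm]
  linear_combination -((-1) ^ m * ((2 * π * Complex.I) ^ (2 * k))⁻¹ *
    iteratedDeriv (2 * k) (phi l (m - 1)) (z + m * τ)) * he

lemma e_int_mul_ne_one {τ : ℂ} (hτ : 0 < τ.im) {n : ℤ} (hn : n ≠ 0) : e (0 + n * τ) ≠ 1 := by
  intro h1
  obtain ⟨m, hm⟩ := e_eq_one_iff.mp h1
  have h2 := congrArg Complex.im hm
  rw [zero_add, show (n * τ : ℂ) = ((n : ℝ) : ℂ) * τ by push_cast; rfl, Complex.im_ofReal_mul,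
    Complex.intCast_im, mul_eq_zero] at h2
  rcases h2 with h2 | h2
  · exact hn (by exact_mod_cast h2)
  · exact hτ.ne' h2

/-! ### The pole at the origin and doubly periodic functions -/

/-- Away from the term with a pole at `0`, the Appell sums are bounded near `z = 0`. -/
lemma exists_norm_appellSum_sub_le {l : ℕ} (hl : 0 < l) (k : ℕ) {τ : ℂ} (hτ : 0 < τ.im) :
    ∃ C : ℝ, ∀ᶠ z in 𝓝 (0 : ℂ), ‖appellSum l k z τ - appellTerm l k 0 z τ‖ ≤ C := by
  obtain ⟨V, hV, u, hu, hb⟩ := exists_appellTerm_bound hl k {0}ᶜ hτ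
    fun n hn ↦ e_int_mul_ne_one hτ hn
  refine ⟨∑' n, |u n|, ?_⟩
  filter_upwards [tendsto_prodMk_left 0 τ hV] with z hz
  have hz' := hb _ hz
  have hb' : ∀ n : ℤ, ‖if n = 0 then (0 : ℂ) else appellTerm l k n z τ‖ ≤ |u n| := by
    intro n
    split_ifs with hn
    · simp
    · exact (hz'.2 n hn).2.trans (le_abs_self _)
  have hs : Summable (fun n : ℤ ↦ if n = 0 then (0 : ℂ) else appellTerm l k n z τ) :=
    hu.abs.of_norm_bounded hb'
  have hs' : Summable (fun n : ℤ ↦ appellTerm l k n z τ) := by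
    refine (summable_congr_cofinite ?_).mpr hs
    filter_upwards [(Set.finite_singleton (0 : ℤ)).compl_mem_cofinite] with n hn
    exact (if_neg hn).symm
  rw [appellSum, hs'.tsum_eq_add_tsum_ite 0, add_sub_cancel_left]
  exact tsum_of_norm_bounded hu.abs.hasSum hb'

lemma OffLattice.ne_zero {z τ : ℂ} (h : OffLattice z τ) : z ≠ 0 := by
  rintro rfl
  exact h.2 0 (by simp)

lemma offLattice_add_one {z τ : ℂ} : OffLattice (z + 1) τ ↔ OffLattice z τ := by
  refine and_congr_right fun _ ↦ forall_congr' fun n ↦ ?_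
  rw [e_eq_e_of_sub_eq_int (x := z + 1 + n * τ) (y := z + n * τ) 1 (by push_cast; ring)]

lemma offLattice_add_tau {z τ : ℂ} : OffLattice (z + τ) τ ↔ OffLattice z τ := by
  refine and_congr_right fun _ ↦ ⟨fun h n ↦ ?_, fun h n ↦ ?_⟩
  · have := h (n - 1)
    push_cast at this
    rwa [show z + τ + (n - 1) * τ = z + n * τ by ring] at this
  · have := h (n + 1)
    push_cast at this
    rwa [show z + (n + 1) * τ = z + τ + n * τ by ring] at this

lemma eventually_e_ne_one : ∀ᶠ z in 𝓝[≠] (0 : ℂ), e z ≠ 1 := by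
  filter_upwards [self_mem_nhdsWithin,
    mem_nhdsWithin_of_mem_nhds (Metric.ball_mem_nhds (0 : ℂ) one_pos)] with z hz hz1 h
  obtain ⟨n, rfl⟩ := e_eq_one_iff.mp h
  rw [mem_ball_zero_iff, Complex.norm_intCast] at hz1
  have : |n| < 1 := by exact_mod_cast hz1
  rw [Int.abs_lt_one_iff] at this
  simp [this] at hz

lemma eventually_offLattice {τ : ℂ} (hτ : 0 < τ.im) : ∀ᶠ z in 𝓝[≠] (0 : ℂ), OffLattice z τ := by
  obtain ⟨V, hV, u, -, hu⟩ := exists_appellTerm_bound one_pos 0 {0}ᶜ hτ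
    fun n hn ↦ e_int_mul_ne_one hτ hn
  filter_upwards [eventually_e_ne_one,
    mem_nhdsWithin_of_mem_nhds (tendsto_prodMk_left 0 τ hV)] with z hz hzV
  refine ⟨hτ, fun n ↦ ?_⟩
  rcases eq_or_ne n 0 with rfl | hn
  · simpa using hz
  · exact ((hu _ hzV).2 n hn).1

/-- A doubly periodic function, holomorphic off the lattice and with a limit at `0`, is constant. -/
lemma eq_of_doubly_periodic {F : ℂ → ℂ} {τ c : ℂ} (hτ : 0 < τ.im)
    (hd : ∀ z, OffLattice z τ → DifferentiableAt ℂ F z)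
    (h1 : ∀ z, OffLattice z τ → F (z + 1) = F z) (h2 : ∀ z, OffLattice z τ → F (z + τ) = F z)
    (hlim : Tendsto F (𝓝[≠] 0) (𝓝 c)) {z : ℂ} (hz : OffLattice z τ) : F z = c := by
  classical
  set G : ℂ → ℂ := fun z ↦ if OffLattice z τ then F z else c with hG
  have hp1 : Function.Periodic G 1 := fun z ↦ by
    by_cases h : OffLattice z τ
    · simp only [hG, offLattice_add_one, h, if_true, h1 z h]
    · simp only [hG, offLattice_add_one, h, if_false]
  have hp2 : Function.Periodic G τ := fun z ↦ by
    by_cases h : OffLattice z τ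
    · simp only [hG, offLattice_add_tau, h, if_true, h2 z h]
    · simp only [hG, offLattice_add_tau, h, if_false]
  have hper : ∀ (m n : ℤ) (z : ℂ), G (z + m * τ + n) = G z := fun m n z ↦ by
    have := hp1.int_mul n (z + m * τ)
    rw [mul_one] at this
    rw [this, hp2.int_mul m z]
  have hdoff : ∀ z, OffLattice z τ → DifferentiableAt ℂ G z := by
    intro z hz
    refine (hd z hz).congr_of_eventuallyEq ?_
    filter_upwards [tendsto_prodMk_left z τ hz.eventually] with x hx
    exact if_pos hx
  have hG0 : G 0 = c := if_neg fun h ↦ h.ne_zero rfl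
  have hd0 : DifferentiableAt ℂ G 0 := by
    refine (Complex.analyticAt_of_differentiable_on_punctured_nhds_of_continuousAt ?_
      ?_).differentiableAt
    · filter_upwards [eventually_offLattice hτ] with x hx
      exact hdoff x hx
    · rw [continuousAt_iff_punctured_nhds, hG0]
      refine hlim.congr' ?_
      filter_upwards [eventually_offLattice hτ] with x hx
      exact (if_pos hx).symm
  have hdiff : Differentiable ℂ G := by
    intro w
    by_cases hw : OffLattice w τ
    · exact hdoff w hw
    · obtain ⟨n, hn⟩ : ∃ n : ℤ, e (w + n * τ) = 1 := by
        by_contra hcon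
        push Not at hcon
        exact hw ⟨hτ, hcon⟩
      obtain ⟨m, hm⟩ := e_eq_one_iff.mp hn
      -- Periodicity moves differentiability from the origin to every lattice point.
      have h3 : G = fun x ↦ G (x + n * τ + (-m : ℤ)) := funext fun x ↦ (hper n (-m) x).symm
      rw [h3]
      have h4 : w + n * τ + ((-m : ℤ) : ℂ) = 0 := by
        push_cast
        rw [hm]
        ring
      have h5 : DifferentiableAt ℂ (fun x : ℂ ↦ x + n * τ + ((-m : ℤ) : ℂ)) w := by fun_prop
      refine DifferentiableAt.comp (g := G) w ?_ h5
      rw [h4]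
      exact hd0
  have hbdd : Bornology.IsBounded (Set.range G) := by
    -- Every value of `G` is attained in the fundamental parallelogram, which lies in this ball;
    -- Liouville's theorem then applies.
    refine ((isCompact_closedBall (0 : ℂ) (1 + ‖τ‖)).image hdiff.continuous).isBounded.subset ?_
    rintro _ ⟨w, rfl⟩
    set b : ℝ := w.im / τ.im with hb
    set a : ℝ := w.re - b * τ.re with ha
    have hw : w = a + b * τ := by
      apply Complex.ext
      · simp [ha]
      · simp [hb, hτ.ne']
    refine ⟨w + ((-⌊b⌋ : ℤ) : ℂ) * τ + ((-⌊a⌋ : ℤ) : ℂ), ?_, hper _ _ _⟩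
    have h5 : w + ((-⌊b⌋ : ℤ) : ℂ) * τ + ((-⌊a⌋ : ℤ) : ℂ) =
        ((Int.fract a : ℝ) : ℂ) + ((Int.fract b : ℝ) : ℂ) * τ := by
      conv_lhs => rw [hw]
      rw [Int.fract, Int.fract]
      push_cast
      ring
    rw [h5, mem_closedBall_zero_iff]
    refine (norm_add_le _ _).trans (add_le_add ?_ ?_)
    · rw [Complex.norm_real, Real.norm_of_nonneg (Int.fract_nonneg a)]
      exact (Int.fract_lt_one a).le
    · rw [norm_mul, Complex.norm_real, Real.norm_of_nonneg (Int.fract_nonneg b)]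
      exact mul_le_of_le_one_left (norm_nonneg _) (Int.fract_lt_one b).le
  have h6 := hdiff.apply_eq_apply_of_bounded hbdd z 0
  rw [hG0] at h6
  rw [← h6]
  exact (if_pos hz).symm

/-! ### Product form of theta and the crank function -/

/-- The product `∏ n ≥ 1, (1 - w q ^ n)`. -/
def eulerProd (q w : ℂ) : ℂ := ∏' n : ℕ, (1 - w * q ^ (n + 1))

lemma summable_norm_mul_pow {q : ℂ} (hq : ‖q‖ < 1) (w : ℂ) :
    Summable fun n : ℕ ↦ ‖-(w * q ^ (n + 1))‖ := by
  simp_rw [norm_neg, norm_mul, norm_pow]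
  exact ((summable_nat_add_iff 1).mpr
    (summable_geometric_of_lt_one (norm_nonneg q) hq)).mul_left _

lemma hasProd_eulerProd {q : ℂ} (hq : ‖q‖ < 1) (w : ℂ) :
    HasProd (fun n : ℕ ↦ 1 - w * q ^ (n + 1)) (eulerProd q w) := by
  simp_rw [sub_eq_add_neg]
  have := (multipliable_one_add_of_summable (summable_norm_mul_pow hq w)).hasProd
  convert this using 1
  simp only [eulerProd, sub_eq_add_neg]

lemma eulerProd_ne_zero {q : ℂ} (hq : ‖q‖ < 1) {w : ℂ} (hw : ∀ n : ℕ, w * q ^ (n + 1) ≠ 1) :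
    eulerProd q w ≠ 0 := by
  have := tprod_one_add_ne_zero_of_summable (f := fun n : ℕ ↦ -(w * q ^ (n + 1)))
    (fun n ↦ by
      rw [← sub_eq_add_neg]
      exact sub_ne_zero.mpr (hw n).symm) (summable_norm_mul_pow hq w)
  simpa only [eulerProd, sub_eq_add_neg] using this

lemma eulerProd_eq_mul {q : ℂ} (hq : ‖q‖ < 1) (w : ℂ) :
    eulerProd q w = (1 - w * q) * eulerProd q (w * q) := by
  have h : ∀ n : ℕ, 1 - w * q ^ (n + 1 + 1) = 1 - w * q * q ^ (n + 1) := fun n ↦ by ring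
  have := tprod_eq_zero_mul' (f := fun n : ℕ ↦ 1 - w * q ^ (n + 1)) (by
    simp_rw [h]
    exact (hasProd_eulerProd hq (w * q)).multipliable)
  simp only [h, zero_add, pow_one] at this
  exact this

lemma differentiable_eulerProd {q : ℂ} (hq : ‖q‖ < 1) : Differentiable ℂ (eulerProd q) := by
  have h : HasProdLocallyUniformlyOn (fun (n : ℕ) w ↦ 1 + -(w * q ^ (n + 1)))
      (fun w ↦ ∏' n : ℕ, (1 + -(w * q ^ (n + 1)))) Set.univ := by
    apply hasProdLocallyUniformlyOn_of_forall_compact isOpen_univ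
    intro K _ hK
    obtain ⟨R, hR⟩ := hK.isBounded.exists_norm_le
    refine (((summable_nat_add_iff 1).mpr (summable_geometric_of_lt_one (norm_nonneg q)
      hq)).mul_left R).hasProdUniformlyOn_nat_one_add hK (.of_forall fun n w hw ↦ ?_)
      (fun _ ↦ by fun_prop)
    rw [norm_neg, norm_mul, norm_pow]
    exact mul_le_mul_of_nonneg_right (hR w hw) (by positivity)
  have h2 := h.differentiableOn (.of_forall fun s ↦ by
    have : DifferentiableOn ℂ (fun w ↦ ∏ n ∈ s, (1 + -(w * q ^ (n + 1)))) Set.univ :=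
      DifferentiableOn.fun_finsetProd fun _ _ ↦ by fun_prop
    simpa [Finset.prod_fn] using this) isOpen_univ
  rw [differentiableOn_univ] at h2
  have h3 : eulerProd q = fun w ↦ ∏' n : ℕ, (1 + -(w * q ^ (n + 1))) := by
    ext w
    simp only [eulerProd, sub_eq_add_neg]
  rwa [h3]

/-- The product form of the odd Jacobi theta function, up to a factor independent of `z`. -/
def thetaProd (τ z : ℂ) : ℂ :=
  (e (-(1 / 2) * z) - e (1 / 2 * z)) * eulerProd (e τ) (e z) * eulerProd (e τ) (e (-1 * z))

lemma norm_e_lt_one {τ : ℂ} (hτ : 0 < τ.im) : ‖e τ‖ < 1 := by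
  rw [norm_e, Real.exp_lt_one_iff]
  nlinarith [Real.pi_pos]

lemma e_half : e (1 / 2) = -1 := by
  simpa using (neg_one_zpow_eq_e 1).symm

lemma thetaProd_add_one (τ z : ℂ) : thetaProd τ (z + 1) = -thetaProd τ z := by
  have h1 : e (z + 1) = e z := e_eq_e_of_sub_eq_int 1 (by simp)
  have h2 : e (-1 * (z + 1)) = e (-1 * z) := e_eq_e_of_sub_eq_int (-1) (by push_cast; ring)
  have h3 : e (1 / 2 * (z + 1)) = -e (1 / 2 * z) := by
    rw [mul_add, mul_one, e_add, e_half]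
    ring
  have h4 : e (-(1 / 2) * (z + 1)) = -e (-(1 / 2) * z) := by
    rw [e_eq_e_of_sub_eq_int (y := -(1 / 2) * z + 1 / 2) (-1) (by push_cast; ring), e_add, e_half]
    ring
  rw [thetaProd, thetaProd, h1, h2, h3, h4]
  ring

/-- The shift removes the factor `1 - w q` from one product and adds `1 - w⁻¹` to the other; the
prefactor supplies the former and absorbs the latter. -/
lemma thetaProd_add_tau {τ : ℂ} (hτ : 0 < τ.im) (z : ℂ) :
    thetaProd τ (z + τ) = -e (-z - 1 / 2 * τ) * thetaProd τ z := by
  have hq := norm_e_lt_one hτ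
  have h1 := eulerProd_eq_mul hq (e z)
  have h2 := eulerProd_eq_mul hq (e (-1 * (z + τ)))
  rw [← e_add] at h1 h2
  rw [show -1 * (z + τ) + τ = -1 * z by ring] at h2
  have h3 : e (1 / 2 * (z + τ)) = e (-(1 / 2) * (z + τ)) * e (z + τ) := by
    rw [← e_add]
    ring_nf
  have h4 : e (-(1 / 2) * (z + τ)) * (1 - e (-1 * z)) =
      -e (-z - 1 / 2 * τ) * (e (-(1 / 2) * z) - e (1 / 2 * z)) := by
    have h5 : e (-(1 / 2) * (z + τ)) = e (-z - 1 / 2 * τ) * e (1 / 2 * z) := by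
      rw [← e_add]
      ring_nf
    have h6 : e (1 / 2 * z) * e (-1 * z) = e (-(1 / 2) * z) := by
      rw [← e_add]
      ring_nf
    rw [h5, ← h6]
    ring
  rw [thetaProd, thetaProd, h1, h2, h3]
  linear_combination (1 - e (z + τ)) * eulerProd (e τ) (e (z + τ)) *
    eulerProd (e τ) (e (-1 * z)) * h4

lemma differentiable_thetaProd {τ : ℂ} (hτ : 0 < τ.im) : Differentiable ℂ (thetaProd τ) := by
  have hq := norm_e_lt_one hτ
  have h1 := differentiable_eulerProd hq
  exact (((differentiable_e_const_mul _).sub (differentiable_e_const_mul _)).mul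
    (h1.comp differentiable_e)).mul (h1.comp (differentiable_e_const_mul _))

lemma tendsto_thetaProd_div {τ : ℂ} (hτ : 0 < τ.im) :
    Tendsto (fun z ↦ thetaProd τ z / z) (𝓝[≠] 0)
      (𝓝 (-(2 * π * Complex.I) * eulerProd (e τ) 1 ^ 2)) := by
  have hq := norm_e_lt_one hτ
  have h1 := (differentiable_eulerProd hq).continuous
  have hd : HasDerivAt (fun z ↦ e (-(1 / 2) * z) - e (1 / 2 * z)) (-(2 * π * Complex.I)) 0 := by
    refine ((hasDerivAt_e_const_mul (-(1 / 2)) 0).sub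
      (hasDerivAt_e_const_mul (1 / 2) 0)).congr_deriv ?_
    rw [mul_zero, mul_zero, e_zero]
    ring
  have h2 := hasDerivAt_iff_tendsto_slope.mp hd
  have h3 : Tendsto (fun z ↦ eulerProd (e τ) (e z) * eulerProd (e τ) (e (-1 * z))) (𝓝[≠] 0)
      (𝓝 (eulerProd (e τ) (e 0) * eulerProd (e τ) (e (-1 * 0)))) :=
    (((h1.comp continuous_e).mul (h1.comp
      (differentiable_e_const_mul _).continuous)).tendsto 0).mono_left nhdsWithin_le_nhds
  have h4 := h2.mul h3
  rw [mul_zero, e_zero, ← sq] at h4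
  refine h4.congr fun z ↦ ?_
  rw [slope_def_field, thetaProd, mul_zero, mul_zero, e_zero]
  ring

/-- The crank function is the inverse theta function up to a factor independent of `z`. -/
lemma modCrank_mul_thetaProd {z : ℂ} {τ : ℍ} (h : OffLattice z τ) :
    modCrank z τ * thetaProd τ z = e (-(τ : ℂ) / 24) * eulerProd (e τ) 1 := by
  have hq := norm_e_lt_one h.1
  have hpow : ∀ n : ℕ, e (τ : ℂ) ^ (n + 1) = e (((n + 1 : ℕ) : ℤ) * τ) := fun n ↦ by
    rw [e_pow]
    push_cast
    rfl
  have hinv : (e z)⁻¹ = e (-1 * z) := by rw [neg_one_mul, e_neg]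
  have h1 : eulerProd (e τ) (e z) ≠ 0 := eulerProd_ne_zero hq fun n ↦ by
    rw [hpow, ← e_add]
    exact h.2 _
  have h2 : eulerProd (e τ) (e (-1 * z)) ≠ 0 := eulerProd_ne_zero hq fun n ↦ by
    rw [hpow, ← e_add]
    intro h3
    apply h.2 (-((n + 1 : ℕ) : ℤ))
    have : z + ((-((n + 1 : ℕ) : ℤ) : ℤ) : ℂ) * τ = -(-1 * z + (((n + 1 : ℕ) : ℤ) : ℂ) * τ) := by
      push_cast
      ring
    rw [this, e_neg, h3, inv_one]
  have h3 : crankGen (e z) (e τ) =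
      eulerProd (e τ) 1 / (eulerProd (e τ) (e z) * eulerProd (e τ) (e (-1 * z))) := by
    have h4 := (hasProd_eulerProd hq 1).div₀
      ((hasProd_eulerProd hq (e z)).mul (hasProd_eulerProd hq (e (-1 * z)))) (mul_ne_zero h1 h2)
    rw [crankGen, hinv, ← h4.tprod_eq]
    simp only [one_mul]
  have h5 : 1 - e z ≠ 0 := sub_ne_zero.mpr fun h6 ↦ h.2 0 (by simpa using h6.symm)
  have h6 : e (z / 2) * (e (-(1 / 2) * z) - e (1 / 2 * z)) = 1 - e z := by
    rw [mul_sub, ← e_add, ← e_add, show z / 2 + -(1 / 2) * z = 0 by ring,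
      show z / 2 + 1 / 2 * z = z by ring, e_zero]
  rw [modCrank, h3, thetaProd]
  have h7 : e (z / 2) * e (-(τ : ℂ) / 24) / (1 - e z) *
      (eulerProd (e τ) 1 / (eulerProd (e τ) (e z) * eulerProd (e τ) (e (-1 * z)))) *
      ((e (-(1 / 2) * z) - e (1 / 2 * z)) * eulerProd (e τ) (e z) *
        eulerProd (e τ) (e (-1 * z))) =
      (e (z / 2) * (e (-(1 / 2) * z) - e (1 / 2 * z))) / (1 - e z) *
        (e (-(τ : ℂ) / 24) * eulerProd (e τ) 1) := by
    generalize e (-(1 / 2) * z) - e (1 / 2 * z) = x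
    generalize eulerProd (e τ) (e z) = a at h1 ⊢
    generalize eulerProd (e τ) (e (-1 * z)) = b at h2 ⊢
    field_simp
  rw [h7, h6, div_self h5, one_mul]

lemma eta_eq_eulerProd (τ : ℍ) : ModularForm.eta τ = e ((τ : ℂ) / 24) * eulerProd (e τ) 1 := by
  rw [eta_eq, eulerProd, show (1 / 24 * τ : ℂ) = τ / 24 by ring]
  simp_rw [ModularForm.eta_q_eq_pow, one_mul]
  rfl

/-! ### Leading polar coefficients at the origin -/

/-- The polar part of `phi l 0` at `0`. -/
lemma exists_phi_zero_eq (l : ℕ) : ∃ H : ℂ → ℂ, AnalyticAt ℂ H 0 ∧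
    ∀ᶠ u in 𝓝[≠] 0, phi l 0 u = -(2 * π * Complex.I)⁻¹ * u⁻¹ + H u := by
  have hdslope : ∀ f : ℂ → ℂ, AnalyticAt ℂ f 0 → AnalyticAt ℂ (dslope f 0) 0 := by
    intro f hf
    refine Complex.analyticAt_of_differentiable_on_punctured_nhds_of_continuousAt ?_
      (continuousAt_dslope_same.mpr hf.differentiableAt)
    filter_upwards [self_mem_nhdsWithin,
      mem_nhdsWithin_of_mem_nhds hf.eventually_analyticAt] with u hu hfu
    exact (differentiableAt_dslope_of_ne hu).mpr hfu.differentiableAt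
  set ψ := dslope (fun u ↦ 1 - e u) 0 with hψ
  have hψa : AnalyticAt ℂ ψ 0 :=
    hdslope _ (analyticAt_const.sub (differentiable_e.analyticAt 0))
  have hψ0 : ψ 0 = -(2 * π * Complex.I) := by
    rw [hψ, dslope_same]
    have h := ((hasDerivAt_e_const_mul 1 0).const_sub 1).deriv
    simpa using h
  -- `K` is `u * phi l 0 u` extended over `0`, the simple zero of `1 - e u` having been divided out.
  -- Its value at `0` is the residue, and its difference quotient is the regular part.
  set K : ℂ → ℂ := fun u ↦ e (l * (((0 : ℤ) : ℂ) + 1 / 2) * u) / ψ u with hK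
  have hne : ψ 0 ≠ 0 := by
    rw [hψ0]
    exact neg_ne_zero.mpr Complex.two_pi_I_ne_zero
  have hKa : AnalyticAt ℂ K 0 := ((differentiable_e_const_mul _).analyticAt 0).div hψa hne
  have hK0 : K 0 = -(2 * π * Complex.I)⁻¹ := by
    simp only [hK, hψ0, mul_zero, e_zero]
    rw [one_div, inv_neg]
  refine ⟨dslope K 0, hdslope K hKa, ?_⟩
  filter_upwards [self_mem_nhdsWithin, eventually_e_ne_one] with u hu hue
  have hu' : u ≠ 0 := hu
  have h1 : (1 - e u) ≠ 0 := sub_ne_zero.mpr hue.symm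
  rw [dslope_of_ne _ hu, slope_def_field, hK0, sub_zero]
  have h2 : ψ u = (1 - e u) / u := by
    rw [hψ, dslope_of_ne _ hu, slope_def_field]
    simp
  have h3 : K u = u * phi l 0 u := by
    simp only [hK, h2, phi]
    field_simp
  rw [h3]
  field_simp
  ring

/-- Differentiating a simple pole `2 k` times gives order `2 k + 1` and a factor `(2 k)!`; this
reaches `2 d + 1` only for `k = d`. -/
lemma tendsto_pow_mul_appellTerm (d k : ℕ) (hk : k ≤ d) (τ : ℂ) :
    Tendsto (fun z ↦ z ^ (2 * d + 1) * appellTerm (2 * d + 1) k 0 z τ) (𝓝[≠] 0)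
      (𝓝 (if k = d then -((2 * d).factorial : ℂ) / (2 * π * Complex.I) ^ (2 * d + 1) else 0)) := by
  obtain ⟨H, hHa, hH⟩ := exists_phi_zero_eq (2 * d + 1)
  have hHk : Tendsto (iteratedDeriv (2 * k) H) (𝓝[≠] 0) (𝓝 (iteratedDeriv (2 * k) H 0)) := by
    rw [iteratedDeriv_eq_iterate]
    exact (hHa.iterated_deriv (2 * k)).continuousAt.tendsto.mono_left nhdsWithin_le_nhds
  have hid : Tendsto (fun z : ℂ ↦ z) (𝓝[≠] 0) (𝓝 0) := tendsto_id.mono_left nhdsWithin_le_nhds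
  have h1 := ((hid.pow (2 * (d - k))).const_mul
    (-(2 * π * Complex.I)⁻¹ * ((2 * k).factorial : ℂ))).add ((hid.pow (2 * d + 1)).mul hHk)
  have h2 := h1.const_mul ((2 * π * Complex.I) ^ (2 * k))⁻¹
  have h3 : (fun z ↦ z ^ (2 * d + 1) * appellTerm (2 * d + 1) k 0 z τ) =ᶠ[𝓝[≠] 0] fun z ↦
      ((2 * π * Complex.I) ^ (2 * k))⁻¹ * (-(2 * π * Complex.I)⁻¹ * ((2 * k).factorial : ℂ) *
        z ^ (2 * (d - k)) + z ^ (2 * d + 1) * iteratedDeriv (2 * k) H z) := by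
    have hH' := eventually_eventually_nhdsWithin.mpr hH
    filter_upwards [hH', self_mem_nhdsWithin,
      mem_nhdsWithin_of_mem_nhds hHa.eventually_analyticAt] with z hz hz0 hza
    have hz0' : z ≠ 0 := hz0
    have h4 : phi (2 * d + 1) 0 =ᶠ[𝓝 z] fun u ↦ -(2 * π * Complex.I)⁻¹ * u⁻¹ + H u := by
      rwa [isOpen_compl_singleton.nhdsWithin_eq hz0] at hz
    have h5 : iteratedDeriv (2 * k) (fun u : ℂ ↦ u⁻¹) z =
        ((2 * k).factorial : ℂ) * z ^ (-1 - (2 * k : ℕ) : ℤ) := by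
      rw [iteratedDeriv_eq_iterate]
      have := iter_deriv_inv (𝕜 := ℂ) (2 * k) z
      rw [(even_two_mul k).neg_one_pow, one_mul] at this
      exact this
    have h6 : iteratedDeriv (2 * k) (phi (2 * d + 1) 0) z =
        -(2 * π * Complex.I)⁻¹ * (((2 * k).factorial : ℂ) * z ^ (-1 - (2 * k : ℕ) : ℤ)) +
          iteratedDeriv (2 * k) H z := by
      rw [h4.iteratedDeriv_eq, iteratedDeriv_fun_add
        (contDiffAt_const.mul (contDiffAt_inv ℂ hz0')) hza.contDiffAt,
        iteratedDeriv_const_mul_field, h5]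
    have h7 : z ^ (2 * d + 1) * z ^ (-1 - (2 * k : ℕ) : ℤ) = z ^ (2 * (d - k)) := by
      rw [← zpow_natCast, ← zpow_natCast, ← zpow_add₀ hz0']
      congr 1
      push_cast [Nat.cast_sub hk]
      ring
    have h8 : appellTerm (2 * d + 1) k 0 z τ =
        ((2 * π * Complex.I) ^ (2 * k))⁻¹ * iteratedDeriv (2 * k) (phi (2 * d + 1) 0) z := by
      simp [appellTerm, appellAux]
    rw [h8, h6]
    linear_combination ((2 * π * Complex.I) ^ (2 * k))⁻¹ * -(2 * π * Complex.I)⁻¹ *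
      ((2 * k).factorial : ℂ) * h7
  refine (tendsto_congr' h3).mpr ?_
  convert h2 using 2
  split_ifs with hkd
  · subst hkd
    simp only [Nat.sub_self, mul_zero, pow_zero, mul_one, zero_pow (Nat.succ_ne_zero _), zero_mul,
      add_zero]
    rw [pow_succ, neg_div, div_eq_mul_inv, mul_inv]
    ring
  · have : 2 * (d - k) ≠ 0 := by omega
    simp [this]

lemma tendsto_pow_mul_appellSum (d k : ℕ) (hk : k ≤ d) {τ : ℂ} (hτ : 0 < τ.im) :
    Tendsto (fun z ↦ z ^ (2 * d + 1) * appellSum (2 * d + 1) k z τ) (𝓝[≠] 0)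
      (𝓝 (if k = d then -((2 * d).factorial : ℂ) / (2 * π * Complex.I) ^ (2 * d + 1) else 0)) := by
  obtain ⟨C, hC⟩ := exists_norm_appellSum_sub_le (l := 2 * d + 1) (by omega) k hτ
  have h1 : Tendsto (fun z : ℂ ↦ z ^ (2 * d + 1) *
      (appellSum (2 * d + 1) k z τ - appellTerm (2 * d + 1) k 0 z τ)) (𝓝[≠] 0) (𝓝 0) := by
    have hz : Tendsto (fun z : ℂ ↦ z ^ (2 * d + 1)) (𝓝[≠] 0) (𝓝 0) := by
      have := (continuous_pow (M := ℂ) (2 * d + 1)).tendsto 0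
      rw [zero_pow (Nat.succ_ne_zero _)] at this
      exact this.mono_left nhdsWithin_le_nhds
    exact hz.zero_mul_isBoundedUnder_le
      ⟨C, eventually_map.mpr (mem_nhdsWithin_of_mem_nhds hC)⟩
  have h2 := (tendsto_pow_mul_appellTerm d k hk τ).add h1
  rw [add_zero] at h2
  exact h2.congr fun z ↦ by ring

/-! ### The combination as a power of the inverse theta function -/

/-- Combinations of the Appell sums annihilating the theta series are powers of the inverse theta
function. -/
theorem thetaProd_pow_mul_sum_appellSum (d : ℕ) (g : ℕ → ℂ) {τ : ℂ}
    (hg : ∀ j < 2 * d + 1, ∑ k ∈ Finset.range (d + 1),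
      g k * thetaSum (2 * d + 1) k (j - ((2 * d + 1 : ℕ) : ℝ) / 2) τ = 0)
    {z : ℂ} (hz : OffLattice z τ) :
    thetaProd τ z ^ (2 * d + 1) *
      ∑ k ∈ Finset.range (d + 1), g k * appellSum (2 * d + 1) k z τ =
      (2 * d).factorial * g d * (eulerProd (e τ) 1 ^ 2) ^ (2 * d + 1) := by
  have hτ := hz.1
  have hodd : Odd (2 * d + 1) := odd_two_mul_add_one d
  have hl0 : 0 < 2 * d + 1 := hodd.pos
  refine eq_of_doubly_periodic (F := fun z ↦ thetaProd τ z ^ (2 * d + 1) *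
    ∑ k ∈ Finset.range (d + 1), g k * appellSum (2 * d + 1) k z τ) hτ ?_ ?_ ?_ ?_ hz
  · intro z hz
    exact ((differentiable_thetaProd hτ z).pow _).mul (DifferentiableAt.fun_sum fun k _ ↦
      (differentiableAt_appellSum_left hl0 k hz).const_mul _)
  · intro z _
    simp only [thetaProd_add_one, appellSum_add_one hodd, hodd.neg_pow, mul_neg,
      Finset.sum_neg_distrib]
    ring
  · intro z hz
    -- The errors in the elliptic transformation assemble into the theta combinations that `hg`
    -- makes zero.
    have h1 : e (-(2 * d + 1 : ℕ) * z - (2 * d + 1 : ℕ) / 2 * τ) *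
        ∑ k ∈ Finset.range (d + 1), g k * appellSum (2 * d + 1) k (z + τ) τ =
        -∑ k ∈ Finset.range (d + 1), g k * appellSum (2 * d + 1) k z τ := by
      rw [eq_neg_iff_add_eq_zero, Finset.mul_sum, ← Finset.sum_add_distrib]
      have h2 : ∀ k ∈ Finset.range (d + 1),
          e (-(2 * d + 1 : ℕ) * z - (2 * d + 1 : ℕ) / 2 * τ) *
            (g k * appellSum (2 * d + 1) k (z + τ) τ) + g k * appellSum (2 * d + 1) k z τ =
          -∑ j ∈ Finset.range (2 * d + 1), e ((j - (2 * d + 1 : ℕ) / 2) * z -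
            (j - (2 * d + 1 : ℕ) / 2) ^ 2 / (2 * (2 * d + 1 : ℕ)) * τ) *
            (g k * thetaSum (2 * d + 1) k (j - ((2 * d + 1 : ℕ) : ℝ) / 2) τ) := by
        intro k _
        have h3 := appellSum_add_tau hodd k hz
        rw [show ∀ a b c x : ℂ, a * (x * b) + x * c = x * (a * b + c) from fun _ _ _ _ ↦ by ring,
          h3, mul_neg, Finset.mul_sum]
        exact congrArg Neg.neg (Finset.sum_congr rfl fun j _ ↦ by ring)
      rw [Finset.sum_congr rfl h2, Finset.sum_neg_distrib, Finset.sum_comm, neg_eq_zero]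
      refine Finset.sum_eq_zero fun j hj ↦ ?_
      rw [← Finset.mul_sum, hg j (Finset.mem_range.mp hj), mul_zero]
    have h4 : (-e (-z - 1 / 2 * τ)) ^ (2 * d + 1) =
        -e (-(2 * d + 1 : ℕ) * z - (2 * d + 1 : ℕ) / 2 * τ) := by
      rw [hodd.neg_pow, e_pow]
      congr 2
      ring
    rw [thetaProd_add_tau hτ, mul_pow, h4]
    linear_combination (-thetaProd τ z ^ (2 * d + 1)) * h1
  · have h1 := (tendsto_thetaProd_div hτ).pow (2 * d + 1)
    have h2 : Tendsto (fun z ↦ ∑ k ∈ Finset.range (d + 1),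
        g k * (z ^ (2 * d + 1) * appellSum (2 * d + 1) k z τ)) (𝓝[≠] 0)
        (𝓝 (∑ k ∈ Finset.range (d + 1), g k * (if k = d then
          -((2 * d).factorial : ℂ) / (2 * π * Complex.I) ^ (2 * d + 1) else 0))) :=
      tendsto_finsetSum _ fun k hk ↦ (tendsto_pow_mul_appellSum d k
        (Nat.lt_succ_iff.mp (Finset.mem_range.mp hk)) hτ).const_mul _
    have h3 := h1.mul h2
    -- The sign of the odd power of `-(2πi)` cancels the sign of the polar coefficient, and the
    -- powers of `2πi` cancel as well.
    have h4 : (-(2 * π * Complex.I) * eulerProd (e τ) 1 ^ 2) ^ (2 * d + 1) *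
        ∑ k ∈ Finset.range (d + 1), g k * (if k = d then
          -((2 * d).factorial : ℂ) / (2 * π * Complex.I) ^ (2 * d + 1) else 0) =
        (2 * d).factorial * g d * (eulerProd (e τ) 1 ^ 2) ^ (2 * d + 1) := by
      rw [Finset.sum_eq_single d (fun k _ hk ↦ by rw [if_neg hk, mul_zero])
        (fun h ↦ absurd (Finset.self_mem_range_succ d) h), if_pos rfl, mul_pow, hodd.neg_pow]
      have := pow_ne_zero (2 * d + 1) Complex.two_pi_I_ne_zero
      generalize (2 * π * Complex.I : ℂ) ^ (2 * d + 1) = c at this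
      field_simp
    rw [h4] at h3
    refine h3.congr' ?_
    filter_upwards [self_mem_nhdsWithin] with z hz
    have hz' : z ≠ 0 := hz
    have h5 : ∑ k ∈ Finset.range (d + 1), g k * (z ^ (2 * d + 1) * appellSum (2 * d + 1) k z τ) =
        z ^ (2 * d + 1) * ∑ k ∈ Finset.range (d + 1), g k * appellSum (2 * d + 1) k z τ := by
      rw [Finset.mul_sum]
      exact Finset.sum_congr rfl fun k _ ↦ by ring
    rw [h5, div_pow]
    field_simp

/-- Exchanging the sums gives coefficients that do not depend on `P`; they serve both for the theta
series and for the Appell sums. -/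
lemma sum_mul_sum_heatCoeff (l d : ℕ) (F P : ℕ → ℂ) (τ : ℍ) :
    ∑ k ∈ Finset.range (d + 1), F k * ∑ i ∈ Finset.range (k + 1), heatCoeff l k i τ * P i =
      ∑ i ∈ Finset.range (d + 1),
        (∑ k ∈ Finset.range (d + 1), F k * heatCoeff l k i τ) * P i := by
  have h1 : ∀ k ∈ Finset.range (d + 1),
      F k * ∑ i ∈ Finset.range (k + 1), heatCoeff l k i τ * P i =
        ∑ i ∈ Finset.range (d + 1), F k * heatCoeff l k i τ * P i := by
    intro k hk
    have hkd := Finset.mem_range.mp hk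
    rw [Finset.sum_subset (Finset.range_subset_range.mpr (by omega : k + 1 ≤ d + 1)),
      Finset.mul_sum]
    · exact Finset.sum_congr rfl fun i _ ↦ by ring
    · intro i _ hi
      rw [Finset.mem_range, not_lt] at hi
      rw [heatCoeff_eq_zero l (by omega : k < i), zero_mul]
  rw [Finset.sum_congr rfl h1, Finset.sum_comm]
  exact Finset.sum_congr rfl fun i _ ↦ by rw [Finset.sum_mul]

end AppellPDE

end

/-! ### Assembly -/

theorem theorem1p3 (l : ℕ) (hl : Odd l) :
    ∃ f : (j : ℕ) → ModularForm 𝒮ℒ (j : ℤ), f 0 ≠ 0 ∧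
      ∀ (τ : ℍ) (z : ℂ), (∀ m n : ℤ, z ≠ (m : ℂ) * (τ : ℂ) + (n : ℂ)) →
        ∑ k ∈ Finset.range ((l - 1) / 2 + 1),
            f (l - 2 * k - 1) τ * AppellPDE.heatPow l k (AppellPDE.appell l) z τ
          = (Nat.factorial (l - 1) : ℂ) * f 0 τ * ModularForm.eta (τ : ℂ) ^ l *
              AppellPDE.modCrank z τ ^ l := by
  open AppellPDE in
  obtain ⟨d, rfl⟩ := hl
  obtain ⟨f, hf0, hf⟩ := exists_modularForm_sum_heatCoeff_thetaSum d
  refine ⟨f, fun h ↦ ?_, fun τ z hz ↦ ?_⟩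
  · have := hf0 UpperHalfPlane.I
    rw [h] at this
    simp at this
  have hoff : OffLattice z τ := offLattice_iff.mpr hz
  have hodd : Odd (2 * d + 1) := odd_two_mul_add_one d
  have hd : (2 * d + 1 - 1) / 2 = d := by omega
  have hidx : ∀ k, 2 * d + 1 - 2 * k - 1 = 2 * d - 2 * k := fun k ↦ by omega
  rw [hd, Nat.add_sub_cancel]
  have hterm : ∀ k ∈ Finset.range (d + 1),
      f (2 * d + 1 - 2 * k - 1) τ * heatPow (2 * d + 1) k (appell (2 * d + 1)) z τ =
        f (2 * d - 2 * k) τ * ∑ i ∈ Finset.range (k + 1),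
          heatCoeff (2 * d + 1) k i τ * appellSum (2 * d + 1) i z τ := fun k _ ↦ by
    rw [heatPow_appell hodd _ hoff, hidx]
  rw [Finset.sum_congr rfl hterm]
  rw [sum_mul_sum_heatCoeff (2 * d + 1) d (fun k ↦ f (2 * d - 2 * k) τ)]
  set g : ℕ → ℂ := fun i ↦
    ∑ k ∈ Finset.range (d + 1), f (2 * d - 2 * k) τ * heatCoeff (2 * d + 1) k i τ with hg
  -- `heatCoeff` is triangular with ones on the diagonal, so only `k = d`, where the form has weight
  -- `0`, contributes.
  have hgd : g d = f 0 τ := by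
    change ∑ k ∈ Finset.range (d + 1), f (2 * d - 2 * k) τ * heatCoeff (2 * d + 1) k d τ = f 0 τ
    rw [Finset.sum_range_succ, Finset.sum_eq_zero, heatCoeff_self, Nat.sub_self, zero_add, mul_one]
    intro k hk
    rw [heatCoeff_eq_zero _ (Finset.mem_range.mp hk), mul_zero]
  have key := thetaProd_pow_mul_sum_appellSum d g (τ := τ) (fun j hj ↦ by
    rw [← hf j hj τ, sum_mul_sum_heatCoeff (2 * d + 1) d (fun k ↦ f (2 * d - 2 * k) τ)]) hoff
  have hcrank := modCrank_mul_thetaProd hoff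
  have hE : eulerProd (e τ) 1 ≠ 0 := by
    have := ModularForm.eta_ne_zero τ.2
    change ModularForm.eta (τ : ℂ) ≠ 0 at this
    rw [eta_eq_eulerProd] at this
    exact right_ne_zero_of_mul this
  have hΘ : thetaProd τ z ≠ 0 := by
    intro h
    rw [h, mul_zero] at hcrank
    exact mul_ne_zero (e_ne_zero _) hE hcrank.symm
  -- Both sides are compared after multiplication by the `l`-th power of the theta product, which is
  -- nonzero off the lattice.
  refine mul_left_cancel₀ (pow_ne_zero (2 * d + 1) hΘ) (key.trans ?_)
  have h1 : ModularForm.eta (τ : ℂ) * (modCrank z τ * thetaProd τ z) = eulerProd (e τ) 1 ^ 2 := by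
    rw [hcrank, eta_eq_eulerProd, neg_div, e_neg]
    have := e_ne_zero ((τ : ℂ) / 24)
    field_simp
  rw [← h1, hgd]
  ring
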